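/- Let $i\ge 1$, $d=2i$, and let $P\subseteq\mathbb R^d$ be a $d$-polytope that is $i$-simplicial (every $i$-face is a simplex) and $i$-simple (every $(d-i-1)$-face lies in exactly $i+1$ facets). Let $F=[u_1,\dots,u_d]$ be a facet of $P$ that is a simplex with vertices $u_1,\dots,u_d$, and for $1\le k\le d$ let $H_k$ be the facet of $P$ with $H_k\cap F=\operatorname{conv}\{u_j: j\ne k\}$. Let $o$ be an interior point of $P$, let $P^*=\{y:\langle y,x-o\rangle\le 1 \text{ for all } x\in P\}$ be the dual polytope, and let $\phi:\mathcal L(P)\to\mathcal L(P^*)$ be an order-reversing bijection between the face lattices (such a bijection exists). Then $v:=\phi(F)$ is a simple vertex of $P^*$, and its neighbours are exactly the distinct vertices $u'_k:=\phi(H_k)$, $1\le k\le d$. Merge $P$ and $P^*$ along $F=[u_1,\dots,u_d]$ and $v$, with the neighbours of $v$ ordered as $u'_1,\dots,u'_d$. That is: apply to $P$ a projective transformation $\pi$ that sends no point of $P$ to infinity, such that the affine hulls of $\pi(F),\pi(H_1),\dots,\pi(H_d)$ bound a $d$-simplex $\Sigma$ containing $\pi(P)$; let $u$ be the vertex of $\Sigma$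 not in $\pi(F)$, let $\alpha$ be the affine transformation with $\alpha(v)=u$ and $\alpha(u'_k)=\pi(u_k)$ for all $k$, and put $$M=\pi(P)\cup\alpha\bigl(\operatorname{conv}(V(P^*)\setminus\{v\})\bigr),$$ where $V(P^*)$ is the vertex set of $P^*$. Then such a merge $M$ exists, and every such $M$ is a self-dual $d$-polytope: the face lattice of $M$ is isomorphic to the face lattice of its dual polytope. -/

import Mathlib

open Set

noncomputable section

namespace Polytope

/-- Euclidean space of dimension `d`. -/
abbrev E (d : ℕ) : Type := EuclideanSpace ℝ (Fin d)

variable {d : ℕ}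

/-- `P ⊆ ℝ^d` is a `d`-polytope: the convex hull of a finite set, with affine span `ℝ^d`. -/
structure IsPolytope (P : Set (E d)) : Prop where
  exists_finset : ∃ s : Finset (E d), P = convexHull ℝ (s : Set (E d))
  affineSpan_eq_top : affineSpan ℝ P = ⊤

/-- The face poset of `P`, ordered by inclusion. The faces are `∅`, `P` itself, and the sets of
points of `P` at which some linear functional is maximal over `P`, that is, the
intersections of `P` with supporting hyperplanes; this is exactly Mathlib's `IsExposed`. -/
abbrev Face (P : Set (E d)) : Type := {F : Set (E d) // IsExposed ℝ P F}

/-- `F` is a (nonempty) `k`-dimensional face of `P`. -/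
structure IsFaceOfDim (P : Set (E d)) (k : ℕ) (F : Set (E d)) : Prop where
  isExposed : IsExposed ℝ P F
  nonempty : F.Nonempty
  finrank_eq : Module.finrank ℝ (vectorSpan ℝ F) = k

/-- `F` is a facet, a face of dimension `d - 1`, of the `d`-polytope `P`. -/
structure IsFacet (P F : Set (E d)) : Prop where
  isExposed : IsExposed ℝ P F
  nonempty : F.Nonempty
  finrank_eq : Module.finrank ℝ (vectorSpan ℝ F) + 1 = d

/-- The vertex set of `P`. -/
def vertices (P : Set (E d)) : Set (E d) := {x | IsExposed ℝ P {x}}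

/-- The neighbours of `v`: the vertices joined to `v` by an edge of `P`. -/
def neighbours (P : Set (E d)) (v : E d) : Set (E d) :=
  {x | x ∈ vertices P ∧ x ≠ v ∧ IsExposed ℝ P (segment ℝ v x)}

/-- `F` is a `k`-simplex. -/
def IsSimplex (k : ℕ) (F : Set (E d)) : Prop :=
  ∃ S : Affine.Simplex ℝ (E d) k, F = convexHull ℝ (range S.points)

/-- `P` is `i`-simplicial: every `i`-face is a simplex. -/
def IsSimplicial (i : ℕ) (P : Set (E d)) : Prop :=
  ∀ F, IsFaceOfDim P i F → IsSimplex i F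

/-- `P` is `i`-simple: every `(d-i-1)`-face is contained in exactly `i + 1` facets. -/
def IsSimple (i : ℕ) (P : Set (E d)) : Prop :=
  ∀ (k : ℕ) (F : Set (E d)), k + i + 1 = d → IsFaceOfDim P k F →
    {H | IsFacet P H ∧ F ⊆ H}.ncard = i + 1

/-- `v` is a simple vertex of the `d`-polytope `P`: it lies in exactly `d` facets. -/
def IsSimpleVertex (P : Set (E d)) (v : E d) : Prop :=
  v ∈ vertices P ∧ {H | IsFacet P H ∧ v ∈ H}.ncard = d

/-- The dual of `P` after translating the point `o` to the origin:
`(P - o)^* = {y | ⟨y, x - o⟩ ≤ 1 for all x ∈ P}`. It is used for `o` in the interior of `P`. -/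
def dual (o : E d) (P : Set (E d)) : Set (E d) :=
  {y | ∀ x ∈ P, inner ℝ y (x - o) ≤ 1}

/-- `P` is self-dual: its face lattice is isomorphic to that of its dual (formed with respect to
any interior point). -/
def IsSelfDual (P : Set (E d)) : Prop :=
  ∀ o ∈ interior P, Nonempty (Face P ≃o Face (dual o P))

/-- The facets `H j` are those adjacent to the simplex facet `[u_1, …, u_d]` of `P` along its
ridges: `H j ∩ [u_1, …, u_d]` is the hull of all the `u k` with `k ≠ j`. -/
def AdjacentFacets (P : Set (E d)) (u : Fin d → E d) (H : Fin d → Set (E d)) : Prop :=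
  ∀ j, IsFacet P (H j) ∧ H j ∩ convexHull ℝ (range u) = convexHull ℝ (u '' {k | k ≠ j})

/-- The projective transformation of `ℝ^d` given in homogeneous coordinates by an
invertible linear map `T` of `ℝ^d × ℝ`; meaningful where the last coordinate
of `T (x, 1)` is nonzero. -/
def projMap (T : (E d × ℝ) ≃ₗ[ℝ] (E d × ℝ)) (x : E d) : E d :=
  (T (x, 1)).2⁻¹ • (T (x, 1)).1

/-- `M` is a merge of the `d`-polytopes `P₁` and `P₂` along the simplex facet
`F = [u_1, …, u_d]` of `P₁` and the simple vertex `v` of `P₂` with neighbours ordered as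
`u'_1, …, u'_d`; here `H j` is the facet of `P₁` adjacent to `F` along the ridge omitting `u_j`.
A projective transformation `T`, with no point of `P₁` sent to infinity (so that the last homogeneous
coordinate may be taken positive on `P₁`), puts `P₁` inside the `d`-simplex `S` bounded by the
hyperplanes spanned by `F` and the `H j`; an affine transformation `α` maps `v` to the
vertex of `S` opposite to `F`, and `u'_k` to `u_k`. The merge is the union of the
transformed `P₁` and of the transformed convex hull of the vertices of `P₂` other than `v`. -/
def IsMerge (P₁ : Set (E d)) (u : Fin d → E d) (H : Fin d → Set (E d))
    (P₂ : Set (E d)) (v : E d) (u' : Fin d → E d) (M : Set (E d)) : Prop :=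
  (IsPolytope P₁ ∧ AffineIndependent ℝ u ∧ IsFacet P₁ (convexHull ℝ (range u)) ∧
    AdjacentFacets P₁ u H) ∧
  (IsPolytope P₂ ∧ IsSimpleVertex P₂ v ∧ Function.Injective u' ∧
    range u' = neighbours P₂ v) ∧
  ∃ (T : (E d × ℝ) ≃ₗ[ℝ] (E d × ℝ)) (S : Affine.Simplex ℝ (E d) d) (α : E d ≃ᵃ[ℝ] E d),
    (∀ x ∈ P₁, 0 < (T (x, 1)).2) ∧
    (∀ k, S.points k.succ = projMap T (u k)) ∧
    (∀ j, S.points 0 ∈ affineSpan ℝ (projMap T '' H j)) ∧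
    projMap T '' P₁ ⊆ convexHull ℝ (range S.points) ∧
    α v = S.points 0 ∧
    (∀ k, α (u' k) = S.points k.succ) ∧
    M = projMap T '' P₁ ∪ α '' convexHull ℝ (vertices P₂ \ {v})

end Polytope

end

open Polytope

/-!
A polytope is determined up to combinatorial equivalence by which of its points satisfy which of its
inequalities with equality: if `K` is both the convex hull of finitely many points and the solution
set of finitely many affine inequalities, then its face lattice is the concept lattice of the
incidence relation between these points and these inequalities, even when some of them are redundant
(`DoubleDescription.nonempty_orderIso`). For `P` and `P^*` the two incidence relations, between
vertices and vertices, are transposes of each other, which gives the anti-isomorphism of face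
lattices. For the same reason a polytope is self-dual as soon as its points and inequalities can be
indexed by one set so that incidence is symmetric, and this is how self-duality of the merge `M` is
shown.

An anti-isomorphism `φ` permutes the vertices of `P` and those of `P^*`, by `σ` and `τ`, in a way that
preserves incidence: `φ` sends the vertex `x` to the facet polar to `σ x`, and the facet polar to `y`
to the vertex `τ y` (`PolarPair.exists_relabelling`). So the simplex facet `F`, polar to `y₀`, becomes
a vertex `v = τ y₀` on exactly `d` facets, and the facets `H k`, polar to `w k`, become its neighbours
`τ (w k)`: each edge at `v` is cut out by `d - 1` of the `d` linearly independent equations at `v`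
(`SimpleCorner`).

The merge exists because the `d + 1` linear forms on `ℝ^d × ℝ` that belong to `F` and the `H k` are
linearly independent, hence can be carried to the barycentric coordinates of any `d`-simplex
(`SimpleCorner.exists_projective`).

For any merge, let `s₀` be the apex of the simplex. A facet of the transformed `P` other than `F` and
the `H k` has `s₀` strictly beyond it, and the cone with apex `s₀` over the simplex is cut out both by
the `H k` and by the facets of the transformed `P^*` at `v`. It follows that `M` is exactly the
solution set of the inequalities of `P` except that of `F` and those of `P^*` except the ones at
`v` (`MergeSetup.eq_setOf`). It is spanned by the vertices `x` of `P` outside `F` and the vertices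
`τ y` of `P^*` with `y ≠ y₀`, where `τ (w k)` is glued to the vertex `u k` of `F`. Pair the point `x`
with the inequality of `σ x`, and the point `τ y` with the inequality of `y`. Incidence is then
symmetric (`MergeSetup.incidence_symm`): mixed pairs are covered by the compatibility of `σ` and `τ`
with incidence, pairs involving some `w k` by the gluing at `u k`, and all other pairs are never
incident, since the point lies strictly on one side of `F` and the facet on the other.
-/

namespace Polytope

variable {d : ℕ}

/-! ### Polyhedra given by finitely many inequalities -/

open Filter Topology in
theorem eventually_lineMap_mem {κ : Type*} [Finite κ] {g : κ → E d →ᵃ[ℝ] ℝ} {x z : E d}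
    (hx : ∀ j, 0 ≤ g j x) (h : ∀ j, g j x = 0 → g j z = 0) :
    ∀ᶠ t in 𝓝 (0 : ℝ), ∀ j, 0 ≤ g j (AffineMap.lineMap x z t) := by
  rw [eventually_all]
  intro j
  simp only [AffineMap.apply_lineMap]
  rcases (hx j).eq_or_lt with h0 | h0
  · simp [← h0, h j h0.symm]
  · have hc : Continuous fun t : ℝ => AffineMap.lineMap (g j x) (g j z) t :=
      AffineMap.lineMap_continuous
    have := hc.tendsto 0
    rw [AffineMap.lineMap_apply_zero] at this
    filter_upwards [this.eventually (lt_mem_nhds h0)] with t ht using ht.le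

theorem mem_openSegment_lineMap_neg (x z : E d) {t : ℝ} :
    x ∈ openSegment ℝ (AffineMap.lineMap x z (-t)) (AffineMap.lineMap x z t : E d) := by
  refine ⟨1 / 2, 1 / 2, by norm_num, by norm_num, by norm_num, ?_⟩
  simp only [AffineMap.lineMap_apply_module]
  module

/-- A point of a polyhedron at which two directions of a line can be followed is not extreme: so an
extreme point is determined by the inequalities that are tight there. -/
theorem eq_of_mem_extremePoints {κ : Type*} [Finite κ] {g : κ → E d →ᵃ[ℝ] ℝ} {x z : E d}
    (hx : x ∈ {z | ∀ j, 0 ≤ g j z}.extremePoints ℝ) (h : ∀ j, g j x = 0 → g j z = 0) : z = x := by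
  obtain ⟨ε, hε, H⟩ := Metric.eventually_nhds_iff.1 (eventually_lineMap_mem hx.1 h)
  have h1 : ∀ j, 0 ≤ g j (AffineMap.lineMap x z (ε / 2)) := H (by
    rw [Real.dist_eq, sub_zero, abs_of_pos (by positivity)]; linarith)
  have h2 : ∀ j, 0 ≤ g j (AffineMap.lineMap x z (-(ε / 2))) := H (by
    rw [Real.dist_eq, sub_zero, abs_neg, abs_of_pos (by positivity)]; linarith)
  have := hx.2 h1 h2 (by rw [openSegment_symm]; exact mem_openSegment_lineMap_neg x z)
  rw [AffineMap.lineMap_apply_module] at this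
  have h3 : (ε / 2) • (z - x) = 0 := by
    calc (ε / 2) • (z - x) = ((1 - ε / 2) • x + (ε / 2) • z) - x := by module
      _ = 0 := by rw [this, sub_self]
  simpa [hε.ne', sub_eq_zero] using h3

/-- Making some of the inequalities that define a polyhedron tight cuts out an exposed face. -/
theorem isExposed_tight {κ : Type*} [Finite κ] (g : κ → E d →ᵃ[ℝ] ℝ) {K : Set (E d)}
    (hK : ∀ z ∈ K, ∀ j, 0 ≤ g j z) (B : Set κ) :
    IsExposed ℝ K {z | z ∈ K ∧ ∀ j ∈ B, g j z = 0} := by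
  rintro ⟨x, hxK, hx⟩
  have hB : B.Finite := B.toFinite
  let l : E d →ₗ[ℝ] ℝ := - ∑ j ∈ hB.toFinset, (g j).linear
  have hl : ∀ z, l z - l x = - ∑ j ∈ hB.toFinset, g j z := by
    intro z
    have : ∀ j ∈ hB.toFinset, (g j).linear z - (g j).linear x = g j z := by
      intro j hj
      rw [← map_sub, ← vsub_eq_sub, AffineMap.linearMap_vsub, hx j (by simpa using hj)]
      simp
    simp only [l, LinearMap.neg_apply, LinearMap.sum_apply]
    rw [← Finset.sum_congr rfl this, Finset.sum_sub_distrib]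
    ring
  refine ⟨LinearMap.toContinuousLinearMap l, ?_⟩
  ext z
  simp only [mem_ofPred_eq, LinearMap.coe_toContinuousLinearMap']
  constructor
  · rintro ⟨hz, hz0⟩
    refine ⟨hz, fun w hw => ?_⟩
    have h1 := hl z
    have h2 := hl w
    rw [Finset.sum_eq_zero (fun j hj => hz0 j (by simpa using hj))] at h1
    have := Finset.sum_nonneg (fun j (_ : j ∈ hB.toFinset) => hK w hw j)
    linarith
  · rintro ⟨hz, hmax⟩
    refine ⟨hz, fun j hj => ?_⟩
    have h1 := hl z
    have h2 := hmax x hxK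
    have h3 := fun j (_ : j ∈ hB.toFinset) => hK z hz j
    have h4 := (Finset.sum_eq_zero_iff_of_nonneg h3).1
      (le_antisymm (by linarith) (Finset.sum_nonneg h3))
    exact h4 j (by simpa using hj)

/-- Every nonempty exposed face of a polyhedron arises by making inequalities tight: those that are
tight at a point of the face where as few as possible are. -/
theorem exists_eq_tight_of_isExposed {κ : Type*} [Finite κ] {g : κ → E d →ᵃ[ℝ] ℝ} {K F : Set (E d)}
    (hK : K = {z | ∀ j, 0 ≤ g j z}) (hF : IsExposed ℝ K F) (hne : F.Nonempty) :
    ∃ B : Set κ, F = {z | z ∈ K ∧ ∀ j ∈ B, g j z = 0} := by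
  have hFK := hF.subset
  have hKc : Convex ℝ K := by
    rw [hK, ofPred_forall]
    exact convex_iInter fun j => (convex_Ici (𝕜 := ℝ) (0 : ℝ)).affine_preimage (g j)
  have hFc : Convex ℝ F := hF.convex hKc
  obtain ⟨x, hxF, hmin⟩ := (measure fun z : E d => {j | g j z = 0}.ncard).wf.has_min F hne
  refine ⟨{j | g j x = 0}, ?_⟩
  ext z
  constructor
  · intro hz
    refine ⟨hFK hz, ?_⟩
    let m : E d := AffineMap.lineMap x z (1 / 2 : ℝ)
    have hm : m ∈ F := hFc.lineMap_mem hxF hz ⟨by norm_num, by norm_num⟩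
    have hgm : ∀ j, g j m = 1 / 2 * g j x + 1 / 2 * g j z := by
      intro j
      rw [AffineMap.apply_lineMap, AffineMap.lineMap_apply_module, smul_eq_mul, smul_eq_mul]
      ring
    have hpos : ∀ w ∈ F, ∀ j, 0 ≤ g j w := fun w hw => by simpa [hK] using hFK hw
    have hsub : {j | g j m = 0} ⊆ {j | g j x = 0} := by
      intro j hj
      have := hgm j
      have h1 := hpos x hxF j
      have h2 := hpos z hz j
      simp only [mem_ofPred_eq] at hj ⊢
      linarith
    have heq : {j | g j m = 0} = {j | g j x = 0} := by
      refine Set.eq_of_subset_of_ncard_le hsub ?_ (Set.toFinite _)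
      exact not_lt.1 (hmin m hm)
    intro j hj
    have h3 : j ∈ {j | g j m = 0} := by rw [heq]; exact hj
    have := hgm j
    simp only [mem_ofPred_eq] at hj h3
    linarith
  · rintro ⟨hz, hz0⟩
    obtain ⟨l, hl⟩ := hF hne
    have hxK : ∀ j, 0 ≤ g j x := by simpa [hK] using hFK hxF
    obtain ⟨ε, hε, H⟩ := Metric.eventually_nhds_iff.1 (eventually_lineMap_mem hxK hz0)
    have h1 : AffineMap.lineMap x z (-(ε / 2)) ∈ K := by
      rw [hK]
      exact H (by rw [Real.dist_eq, sub_zero, abs_neg, abs_of_pos (by positivity)]; linarith)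
    rw [hl] at hxF ⊢
    have h2 := hxF.2 _ h1
    rw [AffineMap.lineMap_apply_module, map_add, map_smul, map_smul, smul_eq_mul, smul_eq_mul] at h2
    have h3 : l x ≤ l z := by
      by_contra hc
      nlinarith
    exact ⟨hz, fun y hy => (hxF.2 y hy).trans h3⟩

theorem vertices_eq_extremePoints {κ : Type*} [Finite κ] {g : κ → E d →ᵃ[ℝ] ℝ} {K : Set (E d)}
    (hK : K = {z | ∀ j, 0 ≤ g j z}) : vertices K = K.extremePoints ℝ := by
  ext x
  constructor
  · intro hx
    exact isExtreme_singleton.1 hx.isExtreme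
  · intro hx
    have := isExposed_tight g (K := K) (fun z hz => by simpa [hK] using hz) {j | g j x = 0}
    suffices h : ({x} : Set (E d)) = {z | z ∈ K ∧ ∀ j ∈ {j | g j x = 0}, g j z = 0} by
      rw [← h] at this
      exact this
    ext z
    constructor
    · rintro rfl
      exact ⟨hx.1, fun j hj => hj⟩
    · rintro ⟨-, hz⟩
      subst hK
      exact eq_of_mem_extremePoints hx hz

theorem finite_extremePoints {κ : Type*} [Finite κ] {g : κ → E d →ᵃ[ℝ] ℝ} {K : Set (E d)}
    (hK : K = {z | ∀ j, 0 ≤ g j z}) : (K.extremePoints ℝ).Finite := by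
  refine Set.Finite.of_injOn (f := fun x => {j | g j x = 0}) (t := univ) (fun _ _ => mem_univ _) ?_
    (Set.toFinite _)
  intro x hx y hy hxy
  subst hK
  refine eq_of_mem_extremePoints hy fun j hj => ?_
  have : j ∈ {j | g j y = 0} := hj
  rw [← show {j | g j x = 0} = {j | g j y = 0} from hxy] at this
  exact this

/-- An exposed face of a convex hull is spanned by the generators that it contains. -/
theorem subset_convexHull_of_isExposed {X K F : Set (E d)} (hK : K = convexHull ℝ X)
    (hF : IsExposed ℝ K F) : F ⊆ convexHull ℝ (X ∩ F) := by
  subst hK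
  intro z hz
  obtain ⟨l, hl⟩ := hF ⟨z, hz⟩
  have hz' := hz
  rw [hl] at hz'
  obtain ⟨hzK, hmax⟩ := hz'
  obtain ⟨ι, _, w, p, hw0, hw1, hp, rfl⟩ := mem_convexHull_iff_exists_fintype.1 hzK
  have hle : ∀ i, l (p i) ≤ l (∑ i, w i • p i) := fun i => hmax _ (subset_convexHull ℝ X (hp i))
  have hsum : ∑ i, w i * (l (∑ i, w i • p i) - l (p i)) = 0 := by
    simp only [mul_sub, Finset.sum_sub_distrib, ← Finset.sum_mul, hw1, one_mul]
    simp [map_sum]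
  have hzero := (Finset.sum_eq_zero_iff_of_nonneg (fun i _ =>
    mul_nonneg (hw0 i) (sub_nonneg.2 (hle i)))).1 hsum
  have key : ∀ i, w i ≠ 0 → p i ∈ X ∩ F := by
    intro i hi
    refine ⟨hp i, ?_⟩
    have h1 := (mul_eq_zero.1 (hzero i (Finset.mem_univ i))).resolve_left hi
    rw [hl]
    refine ⟨subset_convexHull ℝ X (hp i), fun y hy => ?_⟩
    have := hmax y hy
    linarith
  rw [← Finset.sum_filter_ne_zero]
  have hsub : ∑ i ∈ Finset.univ.filter (fun i => w i ≠ 0), w i = 1 := by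
    rw [Finset.sum_filter_ne_zero]; exact hw1
  have h2 : ∑ i ∈ Finset.univ.filter (fun i => w i • p i ≠ 0), w i • p i =
      ∑ i ∈ Finset.univ.filter (fun i => w i ≠ 0), w i • p i := by
    rw [Finset.sum_filter_ne_zero]
    refine (Finset.sum_filter_of_ne ?_).symm
    intro i _ hi hwi
    simp [hwi] at hi
  rw [h2]
  exact (convex_convexHull ℝ _).sum_mem (fun i _ => hw0 i) hsub
    fun i hi => subset_convexHull ℝ _ (key i (by simpa using hi))

/-! ### The face lattice as a concept lattice -/

/-- A polytope `K` given twice: as the convex hull of finitely many points and as the solution set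
of finitely many affine inequalities that have a common strict solution. Redundant points and
inequalities are allowed. -/
structure DoubleDescription {ι κ : Type*} (K : Set (E d)) (p : ι → E d)
    (g : κ → E d →ᵃ[ℝ] ℝ) : Prop where
  eq_convexHull : K = convexHull ℝ (range p)
  eq_setOf : K = {z | ∀ j, 0 ≤ g j z}
  exists_pos : ∃ o, ∀ j, 0 < g j o

/-- A polytope of positive dimension is not a cone: the inequalities are not all tight at one of
its points. -/
theorem DoubleDescription.exists_ne_zero [NeZero d] {ι κ : Type*} [Finite ι] {K : Set (E d)}
    {p : ι → E d} {g : κ → E d →ᵃ[ℝ] ℝ} (h : DoubleDescription K p g) (x : E d) :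
    ∃ j, g j x ≠ 0 := by
  by_contra! hx
  obtain ⟨o, ho⟩ := h.exists_pos
  have hb : Bornology.IsBounded K := by
    rw [h.eq_convexHull, isBounded_convexHull]
    exact (Set.finite_range p).isBounded
  obtain ⟨y, hy, hpos⟩ : ∃ y ≠ x, ∀ j, 0 ≤ g j y := by
    by_cases hκ : IsEmpty κ
    · obtain ⟨y, hy⟩ := exists_ne x
      exact ⟨y, hy, fun j => hκ.elim j⟩
    · obtain ⟨j⟩ := not_isEmpty_iff.1 hκ
      refine ⟨o, ?_, fun j => (ho j).le⟩
      rintro rfl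
      exact (ho j).ne' (hx j)
  obtain ⟨C, hC⟩ := hb.exists_norm_le
  have hray : ∀ t : ℝ, 0 ≤ t → ‖AffineMap.lineMap x y t‖ ≤ C := by
    intro t ht
    apply hC
    rw [h.eq_setOf]
    intro j
    rw [AffineMap.apply_lineMap, AffineMap.lineMap_apply_module, hx j]
    simpa using mul_nonneg ht (hpos j)
  have hyx : 0 < ‖y - x‖ := norm_pos_iff.2 (sub_ne_zero.2 hy)
  have hC0 : 0 ≤ C := (norm_nonneg _).trans (hray 0 le_rfl)
  have := hray ((C + ‖x‖ + 1) / ‖y - x‖) (by positivity)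
  rw [AffineMap.lineMap_apply, vsub_eq_sub, vadd_eq_add] at this
  have h2 : ‖((C + ‖x‖ + 1) / ‖y - x‖) • (y - x)‖ = C + ‖x‖ + 1 := by
    rw [norm_smul, Real.norm_of_nonneg (by positivity)]
    field_simp
  have h3 := norm_sub_norm_le (((C + ‖x‖ + 1) / ‖y - x‖) • (y - x)) (-x)
  rw [h2, sub_neg_eq_add, norm_neg] at h3
  linarith

/-- The face lattice of a polytope is the concept lattice of the incidence relation between any
points and any inequalities that describe it. -/
theorem DoubleDescription.nonempty_orderIso [NeZero d] {ι κ : Type*} [Finite ι] [Finite κ]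
    {K : Set (E d)} {p : ι → E d} {g : κ → E d →ᵃ[ℝ] ℝ} (h : DoubleDescription K p g) :
    Nonempty (Face K ≃o Concept ι κ fun i j => g j (p i) = 0) := by
  set r : ι → κ → Prop := fun i j => g j (p i) = 0 with hr
  have hpos : ∀ z ∈ K, ∀ j, 0 ≤ g j z := fun z hz => by simpa [h.eq_setOf] using hz
  have hpK : ∀ i, p i ∈ K := fun i => by
    rw [h.eq_convexHull]; exact subset_convexHull ℝ _ (mem_range_self i)
  let f : Concept ι κ r → Face K := fun c =>
    ⟨{z | z ∈ K ∧ ∀ j ∈ c.intent, g j z = 0}, isExposed_tight g hpos c.intent⟩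
  have hext : ∀ c : Concept ι κ r, ∀ i, i ∈ c.extent ↔ p i ∈ (f c).1 := by
    intro c i
    rw [← c.lowerPolar_intent, mem_lowerPolar_iff]
    exact ⟨fun hi => ⟨hpK i, fun j hj => hi hj⟩, fun hi j hj => hi.2 j hj⟩
  have hle : ∀ c c', f c ≤ f c' ↔ c ≤ c' := by
    intro c c'
    constructor
    · intro hcc
      rw [← Concept.extent_subset_extent_iff]
      intro i hi
      exact (hext c' i).2 (hcc ((hext c i).1 hi))
    · intro hcc z hz
      exact ⟨hz.1, fun j hj => hz.2 j (Concept.intent_subset_intent_iff.2 hcc hj)⟩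
  have hsurj : Function.Surjective f := by
    rintro ⟨F, hF⟩
    rcases F.eq_empty_or_nonempty with rfl | hne
    · refine ⟨Concept.ofAttributes r univ, Subtype.ext (eq_empty_of_forall_notMem ?_)⟩
      rintro z ⟨-, hz⟩
      obtain ⟨j, hj⟩ := h.exists_ne_zero z
      exact hj (hz j (subset_upperPolar_lowerPolar r univ (mem_univ j)))
    · obtain ⟨B, rfl⟩ := exists_eq_tight_of_isExposed h.eq_setOf hF hne
      refine ⟨Concept.ofAttributes r B, Subtype.ext ?_⟩
      apply Subset.antisymm
      · rintro z ⟨hz, hz0⟩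
        exact ⟨hz, fun j hj => hz0 j (subset_upperPolar_lowerPolar r B hj)⟩
      · intro z hz
        refine ⟨hz.1, fun j hj => ?_⟩
        have hmem := subset_convexHull_of_isExposed h.eq_convexHull hF hz
        have hsub : convexHull ℝ (range p ∩ {z | z ∈ K ∧ ∀ j ∈ B, g j z = 0}) ⊆
            {z | g j z = 0} := by
          refine convexHull_min ?_ ((convex_singleton (𝕜 := ℝ) (0 : ℝ)).affine_preimage (g j))
          rintro _ ⟨⟨i, rfl⟩, -, hi⟩
          exact hj (a := i) fun j' hj' => hi j' hj'
        exact hsub hmem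
  exact ⟨(RelIso.ofSurjective (⟨⟨f, fun c c' hcc => le_antisymm ((hle c c').1 hcc.le)
    ((hle c' c).1 hcc.ge)⟩, hle _ _⟩ : Concept ι κ r ↪o Face K) hsurj).symm⟩

/-! ### Polar pairs of polytopes -/

/-- The affine function `x ↦ 1 - ⟪w, x - o⟫`. -/
noncomputable def slack (o w : E d) : E d →ᵃ[ℝ] ℝ where
  toFun x := 1 - inner ℝ w (x - o)
  linear := - innerₗ (E d) w
  map_vadd' x v := by
    simp only [vadd_eq_add, LinearMap.neg_apply, innerₗ_apply_apply, add_sub_assoc, inner_add_right]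
    ring

theorem slack_apply (o w x : E d) : slack o w x = 1 - inner ℝ w (x - o) := rfl

theorem slack_eq_zero_iff {o w x : E d} : slack o w x = 0 ↔ inner ℝ w (x - o) = 1 := by
  rw [slack_apply, sub_eq_zero, eq_comm]

theorem slack_nonneg_iff {o w x : E d} : 0 ≤ slack o w x ↔ inner ℝ w (x - o) ≤ 1 := by
  rw [slack_apply, sub_nonneg]

/-- `P` and `Q` are polytopes polar to each other, where `o` is the origin for `P` and `c` is the
origin for `Q`. Allowing both origins to vary makes the notion symmetric. -/
structure PolarPair (o c : E d) (P Q : Set (E d)) : Prop where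
  finite_left : (vertices P).Finite
  finite_right : (vertices Q).Finite
  left_eq_convexHull : P = convexHull ℝ (vertices P)
  right_eq_convexHull : Q = convexHull ℝ (vertices Q)
  left_eq : P = {x | ∀ y ∈ vertices Q, inner ℝ (y - c) (x - o) ≤ 1}
  right_eq : Q = {y | ∀ x ∈ vertices P, inner ℝ (y - c) (x - o) ≤ 1}

/-- The face of `P` cut out by the inequality that belongs to the point `y` of its polar. -/
def polarFace (o c : E d) (P : Set (E d)) (y : E d) : Set (E d) :=
  {x | x ∈ P ∧ inner ℝ (y - c) (x - o) = 1}

theorem forall_mem_convexHull_inner_le {X : Set (E d)} {o w : E d} :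
    (∀ x ∈ convexHull ℝ X, inner ℝ w (x - o) ≤ 1) ↔ ∀ x ∈ X, inner ℝ w (x - o) ≤ 1 := by
  refine ⟨fun h x hx => h x (subset_convexHull ℝ X hx), fun h => ?_⟩
  have hc : Convex ℝ (slack o w ⁻¹' Ici 0) := (convex_Ici (0 : ℝ)).affine_preimage _
  intro x hx
  have := convexHull_min (fun x hx => ?_) hc hx
  · simpa [slack_apply] using this
  · simpa [slack_apply] using h x hx

theorem eq_convexHull_vertices {κ : Type*} [Finite κ] {g : κ → E d →ᵃ[ℝ] ℝ} {K : Set (E d)}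
    (hK : K = {z | ∀ j, 0 ≤ g j z}) (hc : IsCompact K) :
    (vertices K).Finite ∧ K = convexHull ℝ (vertices K) := by
  have hfin : (vertices K).Finite := by
    rw [vertices_eq_extremePoints hK]
    exact finite_extremePoints hK
  have hKc : Convex ℝ K := by
    rw [hK, ofPred_forall]
    exact convex_iInter fun j => (convex_Ici (𝕜 := ℝ) (0 : ℝ)).affine_preimage (g j)
  refine ⟨hfin, ?_⟩
  have := closure_convexHull_extremePoints hc hKc
  rw [← vertices_eq_extremePoints hK, (hfin.isClosed_convexHull (𝕜 := ℝ)).closure_eq] at this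
  exact this.symm

theorem isBounded_dual {P : Set (E d)} {o : E d} (ho : o ∈ interior P) :
    Bornology.IsBounded (dual o P) := by
  obtain ⟨r, hr, hball⟩ := Metric.mem_nhds_iff.1 (mem_interior_iff_mem_nhds.1 ho)
  refine (Metric.isBounded_closedBall (x := (0 : E d)) (r := 2 / r)).subset fun y hy => ?_
  rw [mem_closedBall_zero_iff]
  rcases eq_or_ne y 0 with rfl | hy0
  · simp; positivity
  have hn : 0 < ‖y‖ := norm_pos_iff.2 hy0
  have h1 := hy (o + (r / 2 / ‖y‖) • y) (hball (by
    rw [Metric.mem_ball, dist_eq_norm, add_sub_cancel_left, norm_smul, Real.norm_of_nonneg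
      (by positivity)]
    field_simp
    linarith))
  rw [add_sub_cancel_left, inner_smul_right, real_inner_self_eq_norm_sq] at h1
  have h2 : r / 2 / ‖y‖ * ‖y‖ ^ 2 = r / 2 * ‖y‖ := by field_simp
  rw [h2] at h1
  rw [le_div_iff₀ hr]
  linarith

/-- The bipolar theorem. -/
theorem mem_of_forall_dual {P : Set (E d)} {o x : E d} (hc : Convex ℝ P) (hcl : IsClosed P)
    (ho : o ∈ P) (hx : ∀ y ∈ dual o P, inner ℝ y (x - o) ≤ 1) : x ∈ P := by
  by_contra hxP
  obtain ⟨f, m, hfm, hm⟩ := geometric_hahn_banach_closed_point hc hcl hxP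
  set w := (InnerProductSpace.toDual ℝ (E d)).symm f with hw
  have hf : ∀ z, f z = inner ℝ w z := fun z => by
    rw [hw, InnerProductSpace.toDual_symm_apply]
  have hpos : 0 < m - f o := by linarith [hfm o ho]
  have hval : ∀ z, inner ℝ ((m - f o)⁻¹ • w) (z - o) = (f z - f o) / (m - f o) := by
    intro z
    rw [real_inner_smul_left, inner_sub_right, ← hf, ← hf, div_eq_inv_mul]
  have h1 := hx ((m - f o)⁻¹ • w) fun z hz => by
    rw [hval, div_le_one hpos]
    linarith [hfm z hz]
  rw [hval, div_le_one hpos] at h1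
  linarith

/-- The dual is a bounded polyhedron, so it is spanned by its finitely many vertices; by the bipolar
theorem these give finitely many inequalities for `P`, which is then also spanned by its vertices. -/
theorem IsPolytope.polarPair {P : Set (E d)} (hP : IsPolytope P) {o : E d} (ho : o ∈ interior P) :
    PolarPair o 0 P (dual o P) := by
  obtain ⟨s, hs⟩ := hP.exists_finset
  have hcomp : IsCompact P := by rw [hs]; exact s.finite_toSet.isCompact_convexHull (𝕜 := ℝ)
  have hconv : Convex ℝ P := by rw [hs]; exact convex_convexHull ℝ _
  have hoP : o ∈ P := interior_subset ho
  have hQ : dual o P = {y | ∀ x : s, 0 ≤ slack 0 ((x : E d) - o) y} := by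
    ext y
    change (∀ x ∈ P, _) ↔ _
    rw [hs, forall_mem_convexHull_inner_le]
    simp [slack_apply, real_inner_comm]
  have hQcl : IsClosed (dual o P) := by
    have : dual o P = ⋂ x ∈ P, {y | inner ℝ y (x - o) ≤ 1} := by
      ext y; simp [dual]
    rw [this]
    exact isClosed_biInter fun x _ => isClosed_le (by fun_prop) continuous_const
  have hQcomp : IsCompact (dual o P) := Metric.isCompact_of_isClosed_isBounded hQcl
    (isBounded_dual ho)
  obtain ⟨hfin, hQconv⟩ := eq_convexHull_vertices hQ hQcomp
  have hleft : P = {x | ∀ y ∈ vertices (dual o P), inner ℝ (y - 0) (x - o) ≤ 1} := by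
    apply Subset.antisymm
    · intro x hx y hy
      have : y ∈ dual o P := hy.subset rfl
      simpa using this x hx
    · intro x hx
      refine mem_of_forall_dual hconv hcomp.isClosed hoP fun y hy => ?_
      rw [hQconv] at hy
      have := (forall_mem_convexHull_inner_le (o := 0) (w := x - o)).2 (fun y hy => by
        rw [real_inner_comm]; exact hx y hy) y hy
      rwa [sub_zero, real_inner_comm] at this
  have hleft' : P = {x | ∀ y : vertices (dual o P), 0 ≤ slack o (y : E d) x} := by
    conv_lhs => rw [hleft]
    ext x
    simp [slack_apply]
  have : Finite (vertices (dual o P)) := hfin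
  obtain ⟨hfinP, hPconv⟩ := eq_convexHull_vertices hleft' hcomp
  refine ⟨hfinP, hfin, hPconv, hQconv, hleft, ?_⟩
  ext y
  change (∀ x ∈ P, _) ↔ _
  conv_lhs => rw [hPconv]
  rw [forall_mem_convexHull_inner_le]
  simp

namespace PolarPair

variable {o c : E d} {P Q : Set (E d)}

theorem symm (h : PolarPair o c P Q) : PolarPair c o Q P :=
  ⟨h.finite_right, h.finite_left, h.right_eq_convexHull, h.left_eq_convexHull,
    h.right_eq.trans (by simp only [real_inner_comm]),
    h.left_eq.trans (by simp only [real_inner_comm])⟩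

theorem left_eq_slack (h : PolarPair o c P Q) :
    P = {x | ∀ y : vertices Q, 0 ≤ slack o ((y : E d) - c) x} := by
  conv_lhs => rw [h.left_eq]
  ext x
  simp [slack_apply]

theorem doubleDescription (h : PolarPair o c P Q) :
    DoubleDescription P ((↑) : vertices P → E d) fun y : vertices Q => slack o ((y : E d) - c) :=
  ⟨by rw [Subtype.range_coe]; exact h.left_eq_convexHull, h.left_eq_slack,
    ⟨o, fun j => by simp [slack_apply]⟩⟩

theorem vertices_eq (h : PolarPair o c P Q) : vertices P = P.extremePoints ℝ :=
  have : Finite (vertices Q) := h.finite_right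
  vertices_eq_extremePoints h.left_eq_slack

theorem inner_le (h : PolarPair o c P Q) {x y : E d} (hx : x ∈ P) (hy : y ∈ vertices Q) :
    inner ℝ (y - c) (x - o) ≤ 1 := by
  rw [h.left_eq] at hx
  exact hx y hy

theorem origin_mem (h : PolarPair o c P Q) : o ∈ P := by
  rw [h.left_eq]
  simp

theorem isExposed_polarFace (h : PolarPair o c P Q) {y : E d} (hy : y ∈ vertices Q) :
    IsExposed ℝ P (polarFace o c P y) := by
  have := isExposed_tight (κ := Unit) (K := P) (fun _ => slack o (y - c))
    (fun z hz _ => by simpa [slack_apply] using h.inner_le hz hy) univ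
  simp only [slack_eq_zero_iff, mem_univ, forall_const] at this
  exact this

theorem exists_eq_of_isExposed (h : PolarPair o c P Q) {F : Set (E d)} (hF : IsExposed ℝ P F)
    (hne : F.Nonempty) : ∃ B ⊆ vertices Q,
      F = {x | x ∈ P ∧ ∀ y ∈ B, inner ℝ (y - c) (x - o) = 1} := by
  have : Finite (vertices Q) := h.finite_right
  obtain ⟨B, hB⟩ := exists_eq_tight_of_isExposed h.left_eq_slack hF hne
  refine ⟨(↑) '' B, by simp, hB.trans ?_⟩
  simp only [slack_eq_zero_iff, forall_mem_image]

/-- A vertex of `Q` is determined by the inequalities that are tight there. -/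
theorem eq_of_tight (h : PolarPair o c P Q) {y z : E d} (hy : y ∈ vertices Q)
    (hz : ∀ x ∈ vertices P, inner ℝ (y - c) (x - o) = 1 → inner ℝ (z - c) (x - o) = 1) :
    z = y := by
  have : Finite (vertices P) := h.finite_left
  have hy' := hy
  rw [h.symm.vertices_eq] at hy'
  have hQ := h.symm.left_eq_slack
  rw [hQ] at hy'
  refine eq_of_mem_extremePoints hy' fun x hx => ?_
  rw [slack_apply, sub_eq_zero, real_inner_comm, eq_comm] at hx ⊢
  exact hz x x.2 hx

/-- The normals of the inequalities tight at a vertex of `Q` span the whole space. -/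
theorem eq_zero_of_tight (h : PolarPair o c P Q) {y z : E d} (hy : y ∈ vertices Q)
    (hz : ∀ x ∈ vertices P, inner ℝ (y - c) (x - o) = 1 → inner ℝ z (x - o) = 0) : z = 0 := by
  have := h.eq_of_tight hy (z := y + z) fun x hx hxy => by
    rw [add_sub_right_comm, inner_add_left, hxy, hz x hx hxy, add_zero]
  simpa using this

theorem eq_of_polarFace_subset (h : PolarPair o c P Q) {y z : E d} (hy : y ∈ vertices Q)
    (hyz : polarFace o c P y ⊆ polarFace o c P z) : z = y :=
  h.eq_of_tight hy fun _ hx hxy => (hyz ⟨hx.subset rfl, hxy⟩).2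

theorem exists_vertex_of_isExposed (h : PolarPair o c P Q) {F : Set (E d)} (hF : IsExposed ℝ P F)
    (hne : F.Nonempty) : ∃ x ∈ vertices P, x ∈ F := by
  obtain ⟨z, hz⟩ := hne
  obtain ⟨x, hx⟩ := convexHull_nonempty_iff.1
    ⟨z, subset_convexHull_of_isExposed h.left_eq_convexHull hF hz⟩
  exact ⟨x, hx.1, hx.2⟩

theorem exists_tight [NeZero d] (h : PolarPair o c P Q) {y : E d} (hy : y ∈ vertices Q) :
    ∃ x ∈ vertices P, inner ℝ (y - c) (x - o) = 1 := by
  by_contra! H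
  obtain ⟨z, hz⟩ := exists_ne (0 : E d)
  exact hz (h.eq_zero_of_tight hy fun x hx hxy => absurd hxy (H x hx))

theorem isFacet_polarFace [NeZero d] (h : PolarPair o c P Q) {y : E d} (hy : y ∈ vertices Q) :
    IsFacet P (polarFace o c P y) := by
  obtain ⟨a, ha, hay⟩ := h.exists_tight hy
  have haF : a ∈ polarFace o c P y := ⟨ha.subset rfl, hay⟩
  refine ⟨h.isExposed_polarFace hy, ⟨a, haF⟩, ?_⟩
  set V := vectorSpan ℝ (polarFace o c P y)
  have hV : Vᗮ = Submodule.span ℝ {y - c} := by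
    apply le_antisymm
    · intro z hz
      rw [Submodule.mem_orthogonal] at hz
      refine Submodule.mem_span_singleton.2 ⟨inner ℝ z (a - o), ?_⟩
      rw [eq_comm, ← sub_eq_zero]
      refine h.eq_zero_of_tight hy fun x hx hxy => ?_
      have h1 := hz (x -ᵥ a) (vsub_mem_vectorSpan ℝ ⟨hx.subset rfl, hxy⟩ haF)
      rw [real_inner_comm, vsub_eq_sub, ← sub_sub_sub_cancel_right x a o, inner_sub_right] at h1
      rw [inner_sub_left, real_inner_smul_left, hxy]
      linarith
    · rw [Submodule.span_singleton_le_iff_mem, Submodule.mem_orthogonal]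
      have hle : V ≤ LinearMap.ker (innerₗ (E d) (y - c)) := by
        refine Submodule.span_le.2 ?_
        rintro _ ⟨x, hx, x', hx', rfl⟩
        rw [SetLike.mem_coe, LinearMap.mem_ker, innerₗ_apply_apply]
        change inner ℝ (y - c) (x - x') = 0
        rw [← sub_sub_sub_cancel_right x x' o, inner_sub_right, hx.2, hx'.2, sub_self]
      intro w hw
      rw [real_inner_comm]
      exact hle hw
  have hne : y - c ≠ 0 := by
    intro h0
    rw [h0, inner_zero_left] at hay
    exact zero_ne_one hay
  have h1 := Submodule.finrank_add_finrank_orthogonal V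
  rw [hV, finrank_span_singleton hne, finrank_euclideanSpace_fin] at h1
  exact h1

theorem polarFace_ne (h : PolarPair o c P Q) (y : E d) : polarFace o c P y ≠ P := by
  intro H
  have := h.origin_mem
  rw [← H] at this
  simpa using this.2

theorem isFacet_iff [NeZero d] (h : PolarPair o c P Q) (hP : affineSpan ℝ P = ⊤) {F : Set (E d)} :
    IsFacet P F ↔ ∃ y ∈ vertices Q, F = polarFace o c P y := by
  refine ⟨fun hF => ?_, ?_⟩
  · obtain ⟨B, hB, hFB⟩ := h.exists_eq_of_isExposed hF.isExposed hF.nonempty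
    obtain ⟨y, hyB⟩ : B.Nonempty := by
      rw [nonempty_iff_ne_empty]
      rintro rfl
      have hd := hF.finrank_eq
      have : F = P := by simpa using hFB
      rw [this, ← direction_affineSpan, hP, AffineSubspace.direction_top, finrank_top,
        finrank_euclideanSpace_fin] at hd
      omega
    have hsub : F ⊆ polarFace o c P y := by
      rw [hFB]
      exact fun x hx => ⟨hx.1, hx.2 y hyB⟩
    refine ⟨y, hB hyB, hsub.antisymm ?_⟩
    have hy := h.isFacet_polarFace (hB hyB)
    have hspan : vectorSpan ℝ F = vectorSpan ℝ (polarFace o c P y) :=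
      Submodule.eq_of_le_of_finrank_eq (vectorSpan_mono ℝ hsub)
        (by have := hF.finrank_eq; have := hy.finrank_eq; omega)
    obtain ⟨a, ha⟩ := hF.nonempty
    obtain ⟨l, hl⟩ := hF.isExposed hF.nonempty
    intro x hx
    have h1 : x -ᵥ a ∈ vectorSpan ℝ F := by
      rw [hspan]
      exact vsub_mem_vectorSpan ℝ hx (hsub ha)
    have hle : vectorSpan ℝ F ≤ LinearMap.ker (l : E d →ₗ[ℝ] ℝ) := by
      refine Submodule.span_le.2 ?_
      rintro _ ⟨x, hx, x', hx', rfl⟩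
      rw [hl] at hx hx'
      have := hx.2 x' hx'.1
      have := hx'.2 x hx.1
      simp only [vsub_eq_sub, SetLike.mem_coe, LinearMap.mem_ker, ContinuousLinearMap.coe_coe,
        map_sub]
      linarith
    have h2 := hle h1
    simp only [vsub_eq_sub, LinearMap.mem_ker, ContinuousLinearMap.coe_coe, map_sub] at h2
    rw [hl] at ha ⊢
    refine ⟨hx.1, fun z hz => ?_⟩
    have := ha.2 z hz
    linarith
  · rintro ⟨y, hy, rfl⟩
    exact h.isFacet_polarFace hy

end PolarPair

/-! ### Atoms and coatoms of the face lattice -/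

instance (P : Set (E d)) : BoundedOrder (Face P) where
  top := ⟨P, IsExposed.refl P⟩
  le_top F := F.2.subset
  bot := ⟨∅, isExposed_empty⟩
  bot_le _ := empty_subset _

theorem Face.ne_bot_iff {P : Set (E d)} {F : Face P} : F ≠ ⊥ ↔ F.1.Nonempty := by
  rw [nonempty_iff_ne_empty, ne_eq, ne_eq, Subtype.ext_iff]
  rfl

namespace PolarPair

variable {o c : E d} {P Q : Set (E d)}

theorem isAtom_iff (h : PolarPair o c P Q) {F : Face P} :
    IsAtom F ↔ ∃ x ∈ vertices P, F.1 = {x} := by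
  constructor
  · intro hF
    obtain ⟨x, hx, hxF⟩ := h.exists_vertex_of_isExposed F.2 (Face.ne_bot_iff.1 hF.1)
    refine ⟨x, hx, ?_⟩
    have hle : (⟨{x}, hx⟩ : Face P) ≤ F := singleton_subset_iff.2 hxF
    rcases hF.le_iff.1 hle with h1 | h1
    · exact absurd h1 (Face.ne_bot_iff.2 (singleton_nonempty x))
    · rw [← h1]
  · rintro ⟨x, hx, hF⟩
    refine ⟨Face.ne_bot_iff.2 (hF ▸ singleton_nonempty x), fun G hG => ?_⟩
    by_contra hne
    obtain ⟨z, hz⟩ := Face.ne_bot_iff.1 hne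
    refine hG.not_ge fun w hw => ?_
    have hzx : z ∈ F.1 := hG.le hz
    rw [hF] at hw hzx
    rw [mem_singleton_iff.1 hw, ← mem_singleton_iff.1 hzx]
    exact hz

theorem isCoatom_iff [NeZero d] (h : PolarPair o c P Q) {F : Face P} :
    IsCoatom F ↔ ∃ y ∈ vertices Q, F.1 = polarFace o c P y := by
  have hlt : ∀ {y}, ∀ hy : y ∈ vertices Q,
      (⟨polarFace o c P y, h.isExposed_polarFace hy⟩ : Face P) ≠ ⊤ := fun hy H =>
    h.polarFace_ne _ (congrArg Subtype.val H)
  constructor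
  · intro hF
    have hne : F.1.Nonempty := by
      rw [← Face.ne_bot_iff]
      rintro rfl
      obtain ⟨y, hy, -⟩ := h.symm.exists_vertex_of_isExposed (IsExposed.refl Q)
        ⟨c, h.symm.origin_mem⟩
      exact hlt hy (hF.2 _ (bot_lt_iff_ne_bot.2
        (Face.ne_bot_iff.2 (h.isFacet_polarFace hy).nonempty)))
    obtain ⟨B, hB, hFB⟩ := h.exists_eq_of_isExposed F.2 hne
    obtain ⟨y, hyB⟩ : B.Nonempty := by
      rw [nonempty_iff_ne_empty]
      rintro rfl
      exact hF.1 (Subtype.ext (hFB.trans (by simp; rfl)))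
    refine ⟨y, hB hyB, ?_⟩
    have hle : F ≤ ⟨polarFace o c P y, h.isExposed_polarFace (hB hyB)⟩ := by
      intro x hx
      rw [hFB] at hx
      exact ⟨hx.1, hx.2 y hyB⟩
    rcases hF.le_iff.1 hle with h1 | h1
    · exact absurd h1 (hlt (hB hyB))
    · rw [← h1]
  · rintro ⟨y, hy, hF⟩
    refine ⟨fun H => hlt hy ?_, fun G hG => ?_⟩
    · rw [← H]
      exact Subtype.ext hF.symm
    · obtain ⟨x, hx⟩ := (h.isFacet_polarFace hy).nonempty
      have hsub : polarFace o c P y ⊆ G.1 := hF ▸ hG.le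
      obtain ⟨B, hB, hGB⟩ := h.exists_eq_of_isExposed G.2 ⟨x, hsub hx⟩
      rcases B.eq_empty_or_nonempty with rfl | ⟨z, hz⟩
      · exact Subtype.ext (hGB.trans (by simp; rfl))
      · have hGz : G.1 ⊆ polarFace o c P z := by
          rw [hGB]
          exact fun x hx => ⟨hx.1, hx.2 z hz⟩
        have := h.eq_of_polarFace_subset hy (hsub.trans hGz)
        subst this
        exact absurd (hGz.trans hF.ge : G ≤ F) hG.not_ge

/-- The vertices of each polytope are the inequalities of the other, so the two face lattices are the
concept lattices of a relation and of its transpose. -/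
theorem nonempty_face_orderIso [NeZero d] (h : PolarPair o c P Q) :
    Nonempty (Face P ≃o (Face Q)ᵒᵈ) := by
  have : Finite (vertices P) := h.finite_left
  have : Finite (vertices Q) := h.finite_right
  obtain ⟨e⟩ := h.doubleDescription.nonempty_orderIso
  obtain ⟨e'⟩ := h.symm.doubleDescription.nonempty_orderIso
  have hr : (fun (y : vertices Q) (x : vertices P) => slack c ((x : E d) - o) (y : E d) = 0) =
      Function.swap fun (x : vertices P) (y : vertices Q) => slack o ((y : E d) - c) (x : E d) = 0 := by
    funext y x
    simp only [slack_apply, Function.swap, real_inner_comm]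
  rw [hr] at e'
  exact ⟨e.trans ((Concept.swapEquiv.trans e'.symm).dual)⟩

/-- An anti-isomorphism between the face lattices of a polar pair permutes the vertices on both
sides, compatibly with incidence. -/
theorem exists_relabelling [NeZero d] (h : PolarPair o c P Q) (φ : Face P ≃o (Face Q)ᵒᵈ) :
    ∃ (σ : vertices P ≃ vertices P) (τ : vertices Q ≃ vertices Q),
      (∀ y : vertices Q, (OrderDual.ofDual
        (φ ⟨polarFace o c P y, h.isExposed_polarFace y.2⟩)).1 = {(τ y : E d)}) ∧
      ∀ (x : vertices P) (y : vertices Q),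
        inner ℝ ((τ y : E d) - c) ((σ x : E d) - o) = 1 ↔ inner ℝ ((y : E d) - c) ((x : E d) - o) = 1 := by
  -- `φ` exchanges atoms and coatoms
  have hco : ∀ F, IsCoatom F ↔ IsAtom (OrderDual.ofDual (φ F)) := fun F => by
    rw [← isCoatom_dual_iff_isAtom, OrderDual.toDual_ofDual, OrderIso.isCoatom_iff]
  have hat : ∀ F, IsAtom F ↔ IsCoatom (OrderDual.ofDual (φ F)) := fun F => by
    rw [← isAtom_dual_iff_isCoatom, OrderDual.toDual_ofDual, OrderIso.isAtom_iff]
  let Φ : vertices Q → Face P := fun y => ⟨polarFace o c P y, h.isExposed_polarFace y.2⟩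
  let G : vertices P → Face Q := fun x => ⟨polarFace c o Q x, h.symm.isExposed_polarFace x.2⟩
  let pt : vertices P → Face P := fun x => ⟨{(x : E d)}, x.2⟩
  let pt' : vertices Q → Face Q := fun y => ⟨{(y : E d)}, y.2⟩
  have hτ : ∀ y : vertices Q, ∃ y' : vertices Q, φ (Φ y) = OrderDual.toDual (pt' y') := fun y => by
    obtain ⟨y', hy', he⟩ := h.symm.isAtom_iff.1 ((hco (Φ y)).1 (h.isCoatom_iff.2 ⟨y, y.2, rfl⟩))
    exact ⟨⟨y', hy'⟩, congrArg OrderDual.toDual (Subtype.ext he)⟩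
  have hσ : ∀ x : vertices P, ∃ x' : vertices P, φ (pt x) = OrderDual.toDual (G x') := fun x => by
    obtain ⟨x', hx', he⟩ := h.symm.isCoatom_iff.1 ((hat (pt x)).1 (h.isAtom_iff.2 ⟨x, x.2, rfl⟩))
    exact ⟨⟨x', hx'⟩, congrArg OrderDual.toDual (Subtype.ext he)⟩
  choose τ hτ using hτ
  choose σ hσ using hσ
  have : Finite (vertices P) := h.finite_left
  have : Finite (vertices Q) := h.finite_right
  have hτi : Function.Injective τ := by
    intro y z hyz
    have h1 : Φ y = Φ z := φ.injective (by rw [hτ, hτ, hyz])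
    exact Subtype.ext (h.eq_of_polarFace_subset z.2 (congrArg Subtype.val h1).ge)
  have hσi : Function.Injective σ := by
    intro x z hxz
    have h1 : pt x = pt z := φ.injective (by rw [hσ, hσ, hxz])
    exact Subtype.ext (singleton_injective (congrArg Subtype.val h1))
  refine ⟨Equiv.ofBijective σ (Finite.injective_iff_bijective.1 hσi),
    Equiv.ofBijective τ (Finite.injective_iff_bijective.1 hτi), fun y => ?_, fun x y => ?_⟩
  · change (OrderDual.ofDual (φ (Φ y))).1 = _
    rw [hτ]
    rfl
  · have h1 : pt x ≤ Φ y ↔ pt' (τ y) ≤ G (σ x) := by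
      rw [← φ.le_iff_le, hτ, hσ]
      rfl
    have h2 : pt x ≤ Φ y ↔ inner ℝ ((y : E d) - c) ((x : E d) - o) = 1 :=
      ⟨fun H => (H rfl).2, fun H z hz => by rw [mem_singleton_iff.1 hz]; exact ⟨x.2.subset rfl, H⟩⟩
    have h3 : pt' (τ y) ≤ G (σ x) ↔ inner ℝ ((σ x : E d) - o) ((τ y : E d) - c) = 1 :=
      ⟨fun H => (H rfl).2,
        fun H z hz => by rw [mem_singleton_iff.1 hz]; exact ⟨(τ y).2.subset rfl, H⟩⟩
    rw [← h2, h1, h3, real_inner_comm]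
    rfl

end PolarPair

/-! ### Simple vertices and their neighbours -/

/-- A family of `d + 1` points is affinely independent if for each point but the first there is an
affine function vanishing exactly at the others. -/
theorem affineIndependent_of_dual {p : Fin (d + 1) → E d} (b : Fin d → E d →ᵃ[ℝ] ℝ)
    (h0 : ∀ j i, i ≠ j.succ → b j (p i) = 0) (h1 : ∀ j, b j (p j.succ) ≠ 0) :
    AffineIndependent ℝ p := by
  rw [affineIndependent_iff_of_fintype]
  intro w hw0 hw
  rw [Finset.univ.weightedVSub_eq_linear_combination hw0] at hw
  have key : ∀ j : Fin d, w j.succ = 0 := by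
    intro j
    have h2 : ∑ i, w i * b j (p i) = 0 := by
      have h3 : ∀ i, b j (p i) = (b j).linear (p i) + b j 0 := fun i =>
        congrFun (AffineMap.decomp (b j)) (p i)
      calc ∑ i, w i * b j (p i) = (b j).linear (∑ i, w i • p i) + (∑ i, w i) * b j 0 := by
            simp only [h3, mul_add, Finset.sum_add_distrib, map_sum, map_smul, smul_eq_mul,
              Finset.sum_mul]
        _ = 0 := by rw [hw, hw0]; simp
    rw [Finset.sum_eq_single j.succ (fun i _ hi => by rw [h0 j i hi, mul_zero]) (by simp)] at h2
    exact (mul_eq_zero.1 h2).resolve_right (h1 j)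
  intro i
  refine Fin.cases ?_ key i
  rw [Fin.sum_univ_succ] at hw0
  simpa [key] using hw0

/-- The vertex `v` of `Q` lies on exactly the facets of `Q` polar to the points `x k`, and `u' k` is
a further vertex on all of these facets except the one polar to `x k`. -/
structure SimpleCorner (o c : E d) (P Q : Set (E d)) (v : E d) (x u' : Fin d → E d) : Prop where
  left_mem : ∀ k, x k ∈ vertices P
  mem : v ∈ vertices Q
  right_mem : ∀ k, u' k ∈ vertices Q
  tight_iff : ∀ z ∈ vertices P, inner ℝ (v - c) (z - o) = 1 ↔ z ∈ range x
  tight_neighbour_iff : ∀ k j, inner ℝ (u' k - c) (x j - o) = 1 ↔ j ≠ k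

namespace SimpleCorner

variable {o c : E d} {P Q : Set (E d)} {v : E d} {x u' : Fin d → E d}

theorem tight (hc : SimpleCorner o c P Q v x u') (k : Fin d) : inner ℝ (v - c) (x k - o) = 1 :=
  (hc.tight_iff _ (hc.left_mem k)).2 (mem_range_self k)

theorem injective_left (hc : SimpleCorner o c P Q v x u') : Function.Injective x := by
  intro j k hjk
  by_contra hne
  have := (hc.tight_neighbour_iff k j).2 hne
  rw [hjk] at this
  exact (hc.tight_neighbour_iff k k).1 this rfl

theorem injective_right (hc : SimpleCorner o c P Q v x u') : Function.Injective u' := by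
  intro j k hjk
  by_contra hne
  have := (hc.tight_neighbour_iff k j).2 hne
  rw [← hjk] at this
  exact (hc.tight_neighbour_iff j j).1 this rfl

theorem ne (hc : SimpleCorner o c P Q v x u') (k : Fin d) : u' k ≠ v := by
  intro H
  refine (hc.tight_neighbour_iff k k).1 ?_ rfl
  rw [H]
  exact hc.tight k

theorem eq_of_tight (hc : SimpleCorner o c P Q v x u') (h : PolarPair o c P Q) {z : E d}
    (hz : ∀ j, inner ℝ (z - c) (x j - o) = 1) : z = v := by
  refine h.eq_of_tight hc.mem fun y hy hvy => ?_
  obtain ⟨j, rfl⟩ := (hc.tight_iff y hy).1 hvy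
  exact hz j

theorem eq_zero_of_tight (hc : SimpleCorner o c P Q v x u') (h : PolarPair o c P Q) {z : E d}
    (hz : ∀ j, inner ℝ z (x j - o) = 0) : z = 0 := by
  refine h.eq_zero_of_tight hc.mem fun y hy hvy => ?_
  obtain ⟨j, rfl⟩ := (hc.tight_iff y hy).1 hvy
  exact hz j

theorem affineIndependent (hc : SimpleCorner o c P Q v x u') :
    AffineIndependent ℝ (Fin.cons v u' : Fin (d + 1) → E d) := by
  refine affineIndependent_of_dual (fun j => slack c (x j - o)) (fun j i hi => ?_) fun j => ?_
  · rw [slack_eq_zero_iff, real_inner_comm]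
    refine Fin.cases (fun _ => ?_) (fun k hk => ?_) i hi
    · exact hc.tight j
    · exact (hc.tight_neighbour_iff k j).2 fun H => hk (H ▸ rfl)
  · rw [ne_eq, slack_eq_zero_iff, real_inner_comm, Fin.cons_succ, hc.tight_neighbour_iff]
    simp

theorem affineSpan_eq_top (hc : SimpleCorner o c P Q v x u') : affineSpan ℝ Q = ⊤ := by
  have h1 : affineSpan ℝ (range (Fin.cons v u' : Fin (d + 1) → E d)) = ⊤ := by
    rw [hc.affineIndependent.affineSpan_eq_top_iff_card_eq_finrank_add_one]
    simp
  rw [eq_top_iff, ← h1]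
  apply affineSpan_mono
  rintro _ ⟨i, rfl⟩
  refine Fin.cases ?_ (fun k => ?_) i
  · exact hc.mem.subset rfl
  · exact (hc.right_mem k).subset rfl

theorem isPolytope (hc : SimpleCorner o c P Q v x u') (h : PolarPair o c P Q) : IsPolytope Q :=
  ⟨⟨h.finite_right.toFinset, by rw [Finite.coe_toFinset]; exact h.right_eq_convexHull⟩,
    hc.affineSpan_eq_top⟩

theorem isSimpleVertex [NeZero d] (hc : SimpleCorner o c P Q v x u') (h : PolarPair o c P Q) :
    IsSimpleVertex Q v := by
  refine ⟨hc.mem, ?_⟩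
  have hset : {G | IsFacet Q G ∧ v ∈ G} = range fun k => polarFace c o Q (x k) := by
    ext G
    rw [mem_ofPred_eq, h.symm.isFacet_iff hc.affineSpan_eq_top]
    constructor
    · rintro ⟨⟨y, hy, rfl⟩, hv⟩
      obtain ⟨k, rfl⟩ := (hc.tight_iff y hy).1 ((real_inner_comm _ _).trans hv.2)
      exact ⟨k, rfl⟩
    · rintro ⟨k, rfl⟩
      exact ⟨⟨x k, hc.left_mem k, rfl⟩, hc.mem.subset rfl, (real_inner_comm _ _).trans (hc.tight k)⟩
  have hinj : Function.Injective fun k => polarFace c o Q (x k) := fun j k hjk =>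
    hc.injective_left (h.symm.eq_of_polarFace_subset (hc.left_mem k) hjk.ge)
  rw [hset, ncard_range_of_injective hinj, Nat.card_fin]

theorem isExposed_segment (hc : SimpleCorner o c P Q v x u') (h : PolarPair o c P Q) (k : Fin d) :
    IsExposed ℝ Q (segment ℝ v (u' k)) := by
  have hvQ : v ∈ Q := hc.mem.subset rfl
  have huQ : u' k ∈ Q := (hc.right_mem k).subset rfl
  have hext := (h.symm.vertices_eq ▸ hc.right_mem k : u' k ∈ Q.extremePoints ℝ)
  have hQ : Convex ℝ Q := by rw [h.right_eq_convexHull]; exact convex_convexHull ℝ _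
  have hexp := isExposed_tight (κ := {j // j ≠ k}) (K := Q) (fun j => slack c (x j - o))
    (fun z hz j => by rw [slack_nonneg_iff]; exact h.symm.inner_le hz (hc.left_mem j)) univ
  simp only [slack_eq_zero_iff, mem_univ, forall_const] at hexp
  convert hexp using 1
  suffices segment ℝ v (u' k) =
      {z | z ∈ Q ∧ ∀ j : {j // j ≠ k}, inner ℝ (x j - o) (z - c) = 1} by rw [this]
  apply Subset.antisymm
  · have hconv : Convex ℝ {z | z ∈ Q ∧ ∀ j : {j // j ≠ k}, inner ℝ (x j - o) (z - c) = 1} :=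
      hexp.convex hQ
    refine hconv.segment_subset ⟨hvQ, fun j => ?_⟩ ⟨huQ, fun j => ?_⟩
    · rw [real_inner_comm]; exact hc.tight j
    · rw [real_inner_comm]; exact (hc.tight_neighbour_iff k j).2 j.2
  · rintro y ⟨hyQ, hy⟩
    set s := 1 - inner ℝ (u' k - c) (x k - o) with hs
    have hs0 : 0 < s := by
      have h1 : inner ℝ (u' k - c) (x k - o) ≤ 1 := by
        rw [real_inner_comm]; exact h.symm.inner_le huQ (hc.left_mem k)
      have h2 : inner ℝ (u' k - c) (x k - o) ≠ 1 := fun H => (hc.tight_neighbour_iff k k).1 H rfl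
      rw [hs, sub_pos]
      exact lt_of_le_of_ne h1 h2
    set t := (1 - inner ℝ (y - c) (x k - o)) / s with ht
    have ht0 : 0 ≤ t := by
      refine div_nonneg ?_ hs0.le
      rw [sub_nonneg, real_inner_comm]
      exact h.symm.inner_le hyQ (hc.left_mem k)
    have hline : y = v + t • (u' k - v) := by
      rw [← sub_eq_zero]
      refine hc.eq_zero_of_tight h fun j => ?_
      have e : y - (v + t • (u' k - v)) = (y - c) - (v - c) - t • ((u' k - c) - (v - c)) := by
        module
      have e' : ∀ a₁ a₂ a₃ b : E d, inner ℝ (a₁ - a₂ - t • (a₃ - a₂)) b =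
          inner ℝ a₁ b - inner ℝ a₂ b - t * (inner ℝ a₃ b - inner ℝ a₂ b) := by
        intro a₁ a₂ a₃ b
        simp only [inner_sub_left, real_inner_smul_left]
      rw [e, e', hc.tight j]
      by_cases hj : j = k
      · subst hj
        have : t * s = 1 - inner ℝ (y - c) (x j - o) := div_mul_cancel₀ _ hs0.ne'
        rw [hs] at this
        linarith
      · rw [(hc.tight_neighbour_iff k j).2 hj, real_inner_comm, hy ⟨j, hj⟩]
        ring
    rcases le_or_gt t 1 with ht1 | ht1
    · rw [hline, segment_eq_image']
      exact ⟨t, ⟨ht0, ht1⟩, rfl⟩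
    · have hmem : u' k ∈ segment ℝ v y := by
        rw [segment_eq_image']
        refine ⟨t⁻¹, ⟨by positivity, inv_le_one_of_one_le₀ ht1.le⟩, ?_⟩
        simp only
        rw [hline, add_sub_cancel_left, smul_smul, inv_mul_cancel₀ (by positivity), one_smul,
          add_sub_cancel]
      rcases (mem_extremePoints_iff_forall_segment.1 hext).2 v hvQ y hyQ hmem with H | H
      · exact absurd H.symm (hc.ne k)
      · rw [H]
        exact right_mem_segment ℝ _ _

theorem range_eq_neighbours (hc : SimpleCorner o c P Q v x u') (h : PolarPair o c P Q) :
    range u' = neighbours Q v := by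
  apply Subset.antisymm
  · rintro _ ⟨k, rfl⟩
    exact ⟨hc.right_mem k, hc.ne k, hc.isExposed_segment h k⟩
  · rintro y ⟨hy, hyv, hseg⟩
    obtain ⟨B, hB, hBe⟩ := h.symm.exists_eq_of_isExposed hseg ⟨v, left_mem_segment ℝ _ _⟩
    have hv : v ∈ segment ℝ v y := left_mem_segment ℝ _ _
    have hy' : y ∈ segment ℝ v y := right_mem_segment ℝ _ _
    rw [hBe] at hv hy'
    obtain ⟨k, hk⟩ : ∃ k, x k ∉ B := by
      by_contra! H
      exact hyv (hc.eq_of_tight h fun j => by rw [real_inner_comm]; exact hy'.2 _ (H j))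
    have hmem : u' k ∈ segment ℝ v y := by
      rw [hBe]
      refine ⟨(hc.right_mem k).subset rfl, fun z hz => ?_⟩
      obtain ⟨j, rfl⟩ := (hc.tight_iff z (hB hz)).1 (by rw [real_inner_comm]; exact hv.2 z hz)
      rw [real_inner_comm, hc.tight_neighbour_iff]
      rintro rfl
      exact hk hz
    have hext := (h.symm.vertices_eq ▸ hc.right_mem k : u' k ∈ Q.extremePoints ℝ)
    rcases (mem_extremePoints_iff_forall_segment.1 hext).2 v hv.1 y hy'.1 hmem with H | H
    · exact absurd H.symm (hc.ne k)
    · exact ⟨k, H.symm⟩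

end SimpleCorner

/-! ### The projective transformation -/

/-- The linear form on `ℝ^d × ℝ` that extends `slack o w` from the hyperplane `t = 1`. -/
noncomputable def homSlack (o w : E d) : (E d × ℝ) →ₗ[ℝ] ℝ :=
  LinearMap.snd ℝ (E d) ℝ -
    innerₗ (E d) w ∘ₗ (LinearMap.fst ℝ (E d) ℝ - (LinearMap.snd ℝ (E d) ℝ).smulRight o)

theorem homSlack_apply (o w : E d) (z : E d × ℝ) :
    homSlack o w z = z.2 - inner ℝ w (z.1 - z.2 • o) := rfl

theorem homSlack_one (o w x : E d) : homSlack o w (x, 1) = slack o w x := by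
  rw [homSlack_apply, one_smul, slack_apply]

/-- In homogeneous coordinates, the hyperplane of a facet is spanned by the facet. -/
theorem PolarPair.mem_span_of_homSlack_eq_zero [NeZero d] {o c : E d} {P Q : Set (E d)}
    (h : PolarPair o c P Q) {y : E d} (hy : y ∈ vertices Q) {z : E d × ℝ}
    (hz : homSlack o (y - c) z = 0) :
    z ∈ Submodule.span ℝ ((fun x : E d => (x, (1 : ℝ))) '' polarFace o c P y) := by
  by_contra hnot
  obtain ⟨L, hLz, hL⟩ := Submodule.exists_le_ker_of_notMem hnot
  let a : E d := (InnerProductSpace.toDual ℝ (E d)).symm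
    (LinearMap.toContinuousLinearMap (L ∘ₗ LinearMap.inl ℝ (E d) ℝ))
  have ha : ∀ x, inner ℝ a x = L (x, 0) := fun x => by
    simp only [a, InnerProductSpace.toDual_symm_apply]
    rfl
  have hLval : ∀ x t, L (x, t) = inner ℝ a (x - t • o) + t * L (o, 1) := by
    intro x t
    rw [ha, ← smul_eq_mul, ← map_smul, ← map_add]
    simp
  have haw : a = (-L (o, 1)) • (y - c) := by
    rw [← sub_eq_zero]
    refine h.eq_zero_of_tight hy fun x hx hxy => ?_
    have h1 : L (x, 1) = 0 := hL (Submodule.subset_span ⟨x, ⟨hx.subset rfl, hxy⟩, rfl⟩)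
    rw [hLval, one_smul] at h1
    rw [inner_sub_left, real_inner_smul_left, hxy]
    linarith
  apply hLz
  obtain ⟨x, t⟩ := z
  rw [homSlack_apply] at hz
  rw [hLval, haw, real_inner_smul_left]
  simp only at hz
  linear_combination L (o, 1) * hz

/-- The projective transformation of a merge exists: the linear forms belonging to a simplex facet
and its adjacent facets are coordinates on `ℝ^d × ℝ`, so they can be carried to the coordinate forms
of any given simplex. -/
theorem SimpleCorner.exists_projective [NeZero d] {o c : E d} {P Q : Set (E d)} {y : E d}
    {u w : Fin d → E d} (hc : SimpleCorner o c P Q y u w) (h : PolarPair o c P Q)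
    (S : Affine.Simplex ℝ (E d) d) :
    ∃ T : (E d × ℝ) ≃ₗ[ℝ] (E d × ℝ), (∀ x ∈ P, 0 < (T (x, 1)).2) ∧
      (∀ k, S.points k.succ = projMap T (u k)) ∧
      (∀ j, S.points 0 ∈ affineSpan ℝ (projMap T '' polarFace o c P (w j))) ∧
      projMap T '' P ⊆ convexHull ℝ (range S.points) := by
  let q : Fin (d + 1) → E d := Fin.cons y w
  have hqQ : ∀ i, q i ∈ vertices Q := fun i => Fin.cases hc.mem hc.right_mem i
  let Θ : (E d × ℝ) →ₗ[ℝ] (Fin (d + 1) → ℝ) := LinearMap.pi fun i => homSlack o (q i - c)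
  have hΘ : ∀ z i, Θ z i = homSlack o (q i - c) z := fun _ _ => rfl
  have hΘinj : ∀ z, Θ z = 0 → z = 0 := by
    rintro ⟨x, t⟩ hz
    have h1 : ∀ i, t - inner ℝ (q i - c) (x - t • o) = 0 := fun i => congrFun hz i
    have hle : vectorSpan ℝ (range q) ≤ LinearMap.ker (innerₗ (E d) (x - t • o)) := by
      refine Submodule.span_le.2 ?_
      rintro _ ⟨_, ⟨i, rfl⟩, _, ⟨j, rfl⟩, rfl⟩
      rw [SetLike.mem_coe, LinearMap.mem_ker, innerₗ_apply_apply]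
      change inner ℝ _ (q i - q j) = 0
      rw [← sub_sub_sub_cancel_right (q i) (q j) c, inner_sub_right, real_inner_comm,
        real_inner_comm _ (x - t • o)]
      linarith [h1 i, h1 j]
    rw [hc.affineIndependent.vectorSpan_eq_top_of_card_eq_finrank_add_one (by simp)] at hle
    have h2 : x - t • o = 0 := inner_self_eq_zero.1 (hle (Submodule.mem_top (x := x - t • o)))
    have h3 := h1 0
    rw [h2, inner_zero_right, sub_zero] at h3
    rw [h3, zero_smul, sub_zero] at h2
    rw [h2, h3, Prod.mk_zero_zero]
  let Ψ : (Fin (d + 1) → ℝ) →ₗ[ℝ] (E d × ℝ) :=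
    (Fintype.linearCombination ℝ S.points).prod (Fintype.linearCombination ℝ fun _ => (1 : ℝ))
  have hΨ : ∀ a, Ψ a = (∑ i, a i • S.points i, ∑ i, a i) := fun a => by
    simp [Ψ, Fintype.linearCombination_apply]
  have hΨinj : ∀ a, Ψ a = 0 → a = 0 := by
    intro a ha
    rw [hΨ, Prod.mk_eq_zero] at ha
    have := affineIndependent_iff.1 S.independent Finset.univ a ha.2 ha.1
    funext i
    exact this i (Finset.mem_univ i)
  have hinj : Function.Injective (Ψ ∘ₗ Θ) := by
    rw [← LinearMap.ker_eq_bot, LinearMap.ker_eq_bot']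
    exact fun z hz => hΘinj z (hΨinj _ hz)
  let T : (E d × ℝ) ≃ₗ[ℝ] (E d × ℝ) := LinearEquiv.ofInjectiveEndo (Ψ ∘ₗ Θ) hinj
  have hT : ∀ z, T z = (∑ i, Θ z i • S.points i, ∑ i, Θ z i) := fun z => hΨ (Θ z)
  have hnonneg : ∀ x ∈ P, ∀ i, 0 ≤ Θ (x, 1) i := by
    intro x hx i
    rw [hΘ, homSlack_one, slack_nonneg_iff]
    exact h.inner_le hx (hqQ i)
  have hpos : ∀ x ∈ P, 0 < (T (x, 1)).2 := by
    intro x hx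
    rw [hT]
    change 0 < ∑ i, Θ (x, 1) i
    refine lt_of_le_of_ne (Finset.sum_nonneg fun i _ => hnonneg x hx i) fun H => ?_
    have h1 := (Finset.sum_eq_zero_iff_of_nonneg fun i _ => hnonneg x hx i).1 H.symm
    have h2 := hΘinj (x, 1) (funext fun i => h1 i (Finset.mem_univ i))
    exact one_ne_zero (congrArg Prod.snd h2)
  refine ⟨T, hpos, fun k => ?_, fun j => ?_, ?_⟩
  · have hu : ∀ i, i ≠ k.succ → Θ (u k, 1) i = 0 := by
      intro i hi
      rw [hΘ, homSlack_one, slack_eq_zero_iff]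
      refine Fin.cases (fun _ => ?_) (fun j hj => ?_) i hi
      · exact hc.tight k
      · exact (hc.tight_neighbour_iff j k).2 fun H => hj (H ▸ rfl)
    have h1 := hpos (u k) ((hc.left_mem k).subset rfl)
    rw [projMap]
    rw [hT] at h1 ⊢
    rw [Finset.sum_eq_single k.succ (fun i _ hi => hu i hi) (by simp)] at h1 ⊢
    rw [Finset.sum_eq_single k.succ (fun i _ hi => by rw [hu i hi, zero_smul]) (by simp),
      smul_smul, inv_mul_cancel₀ h1.ne', one_smul]
  · obtain ⟨x₀, hx₀⟩ := (h.isFacet_polarFace (hc.right_mem j)).nonempty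
    let z := T.symm (S.points 0, 1)
    have hTz : T z = (S.points 0, 1) := T.apply_symm_apply _
    -- the apex has coordinates `(1, 0, …, 0)`
    have hz : Θ z = Pi.single 0 1 := by
      rw [← sub_eq_zero]
      apply hΨinj
      rw [map_sub, sub_eq_zero]
      refine (show Ψ (Θ z) = T z from rfl).trans (hTz.trans ?_)
      rw [hΨ]
      simp [Pi.single_apply]
    have hspan := h.mem_span_of_homSlack_eq_zero (hc.right_mem j) (z := z) (by
      have := hΘ z j.succ
      rw [hz, Pi.single_eq_of_ne (Fin.succ_ne_zero j)] at this
      exact this.symm)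
    let A := projMap T '' polarFace o c P (w j)
    let D : (E d × ℝ) →ₗ[ℝ] E d := (LinearMap.fst ℝ (E d) ℝ -
      (LinearMap.snd ℝ (E d) ℝ).smulRight (projMap T x₀)) ∘ₗ T.toLinearMap
    have hD : ∀ z, D z = (T z).1 - (T z).2 • projMap T x₀ := fun _ => rfl
    have hle : Submodule.span ℝ ((fun x : E d => (x, (1 : ℝ))) '' polarFace o c P (w j)) ≤
        (vectorSpan ℝ A).comap D := by
      refine Submodule.span_le.2 ?_
      rintro _ ⟨x, hx, rfl⟩
      have h1 : D (x, 1) = (T (x, 1)).2 • (projMap T x -ᵥ projMap T x₀) := by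
        have h2 : (T (x, 1)).2 • projMap T x = (T (x, 1)).1 := by
          rw [projMap, smul_smul, mul_inv_cancel₀ (hpos x hx.1).ne', one_smul]
        rw [hD, vsub_eq_sub, smul_sub, h2]
      rw [SetLike.mem_coe, Submodule.mem_comap, h1]
      exact Submodule.smul_mem _ _ (vsub_mem_vectorSpan ℝ (mem_image_of_mem _ hx)
        (mem_image_of_mem _ hx₀))
    have h2 := hle hspan
    rw [Submodule.mem_comap, hD, hTz, one_smul] at h2
    have h3 := vadd_mem_affineSpan_of_mem_affineSpan_of_mem_vectorSpan
      (subset_affineSpan ℝ A (mem_image_of_mem _ hx₀)) h2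
    simpa using h3
  · rintro _ ⟨x, hx, rfl⟩
    have h1 := hpos x hx
    rw [projMap]
    rw [hT] at h1 ⊢
    change 0 < ∑ i, Θ (x, 1) i at h1
    exact Finset.centerMass_mem_convexHull _ (fun i _ => hnonneg x hx i) h1
      fun i _ => mem_range_self i

/-! ### Projective images and barycentric coordinates -/

/-- A projective transformation that is finite on a convex hull maps it into the convex hull of the
images of the generators. -/
theorem projMap_image_convexHull_subset {T : (E d × ℝ) ≃ₗ[ℝ] (E d × ℝ)} {X : Set (E d)}
    (hT : ∀ x ∈ X, 0 < (T (x, 1)).2) :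
    projMap T '' convexHull ℝ X ⊆ convexHull ℝ (projMap T '' X) := by
  rintro _ ⟨x, hx, rfl⟩
  obtain ⟨ι, _, a, p, ha0, ha1, hp, rfl⟩ := mem_convexHull_iff_exists_fintype.1 hx
  have hTx : T (∑ i, a i • p i, 1) = ∑ i, a i • T (p i, 1) := by
    have : (∑ i, a i • p i, (1 : ℝ)) = ∑ i, a i • (p i, (1 : ℝ)) := by
      ext1
      · simp [Prod.fst_sum]
      · simp [Prod.snd_sum, ha1]
    simp only [this, map_sum, map_smul]
  have h1 : (T (∑ i, a i • p i, 1)).1 = ∑ i, (a i * (T (p i, 1)).2) • projMap T (p i) := by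
    rw [hTx, Prod.fst_sum]
    refine Finset.sum_congr rfl fun i _ => ?_
    rw [Prod.smul_fst, projMap, smul_smul, mul_assoc, mul_inv_cancel₀ (hT _ (hp i)).ne', mul_one]
  have h2 : (T (∑ i, a i • p i, 1)).2 = ∑ i, a i * (T (p i, 1)).2 := by
    rw [hTx, Prod.snd_sum]
    rfl
  have h0 : ∀ i, 0 ≤ a i * (T (p i, 1)).2 := fun i => mul_nonneg (ha0 i) (hT _ (hp i)).le
  rw [projMap, h1, h2]
  refine Finset.centerMass_mem_convexHull _ (fun i _ => h0 i) ?_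
    fun i _ => mem_image_of_mem _ (hp i)
  refine lt_of_le_of_ne (Finset.sum_nonneg fun i _ => h0 i) fun H => ?_
  have h3 := (Finset.sum_eq_zero_iff_of_nonneg fun i _ => h0 i).1 H.symm
  have h4 : ∀ i, a i = 0 := fun i =>
    (mul_eq_zero.1 (h3 i (Finset.mem_univ i))).resolve_right (hT _ (hp i)).ne'
  simp [h4] at ha1

/-- The affine basis formed by the vertices of a `d`-simplex in `ℝ^d`. -/
noncomputable def simplexBasis (S : Affine.Simplex ℝ (E d) d) :
    AffineBasis (Fin (d + 1)) ℝ (E d) :=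
  ⟨S.points, S.independent, S.span_eq_top (by simp)⟩

theorem simplexBasis_apply (S : Affine.Simplex ℝ (E d) d) (i : Fin (d + 1)) :
    simplexBasis S i = S.points i := rfl

theorem apply_eq_sum_coord (S : Affine.Simplex ℝ (E d) d) (f : E d →ᵃ[ℝ] ℝ) (z : E d) :
    f z = ∑ i, (simplexBasis S).coord i z * f (S.points i) := by
  conv_lhs => rw [← (simplexBasis S).affineCombination_coord_eq_self z]
  rw [Finset.map_affineCombination _ _ _ ((simplexBasis S).sum_coord_apply_eq_one z),
    Finset.affineCombination_eq_linear_combination _ _ _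
      ((simplexBasis S).sum_coord_apply_eq_one z)]
  rfl

theorem coord_eq_zero_or {S : Affine.Simplex ℝ (E d) d} {f : E d →ᵃ[ℝ] ℝ} {z : E d}
    (hz : ∀ i, 0 ≤ (simplexBasis S).coord i z) (hf : ∀ i, 0 ≤ f (S.points i)) (h0 : f z = 0)
    (i : Fin (d + 1)) : (simplexBasis S).coord i z = 0 ∨ f (S.points i) = 0 := by
  rw [apply_eq_sum_coord S, Finset.sum_eq_zero_iff_of_nonneg
    fun i _ => mul_nonneg (hz i) (hf i)] at h0
  exact mul_eq_zero.1 (h0 i (Finset.mem_univ i))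

theorem apply_eq_coord_mul {S : Affine.Simplex ℝ (E d) d} {f : E d →ᵃ[ℝ] ℝ} (i : Fin (d + 1))
    (hf : ∀ j ≠ i, f (S.points j) = 0) (z : E d) :
    f z = (simplexBasis S).coord i z * f (S.points i) := by
  rw [apply_eq_sum_coord S]
  exact Finset.sum_eq_single i (fun j _ hj => by rw [hf j hj, mul_zero]) (by simp)

theorem eq_zero_of_mem_affineSpan {A : Set (E d)} {f : E d →ᵃ[ℝ] ℝ} (hf : ∀ z ∈ A, f z = 0)
    {z : E d} (hz : z ∈ affineSpan ℝ A) : f z = 0 := by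
  have hle : affineSpan ℝ A ≤ (affineSpan ℝ {(0 : ℝ)}).comap f :=
    affineSpan_le.2 fun z hz => by
      rw [SetLike.mem_coe, AffineSubspace.mem_comap, AffineSubspace.mem_affineSpan_singleton]
      exact hf z hz
  have := hle hz
  rwa [AffineSubspace.mem_comap, AffineSubspace.mem_affineSpan_singleton] at this

/-- The pullback of `slack o w` along the inverse of the projective transformation `T`, up to the
positive factor that makes it affine. -/
noncomputable def projSlack (T : (E d × ℝ) ≃ₗ[ℝ] (E d × ℝ)) (o w : E d) : E d →ᵃ[ℝ] ℝ where
  toFun z := homSlack o w (T.symm (z, 1))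
  linear := homSlack o w ∘ₗ T.symm.toLinearMap ∘ₗ LinearMap.inl ℝ (E d) ℝ
  map_vadd' z v := by
    have : (v + z, (1 : ℝ)) = (v, 0) + (z, 1) := by simp
    rw [vadd_eq_add, vadd_eq_add, this, map_add, map_add]
    rfl

theorem projSlack_apply (T : (E d × ℝ) ≃ₗ[ℝ] (E d × ℝ)) (o w z : E d) :
    projSlack T o w z = homSlack o w (T.symm (z, 1)) := rfl

theorem projSlack_projMap {T : (E d × ℝ) ≃ₗ[ℝ] (E d × ℝ)} {x : E d} (hx : 0 < (T (x, 1)).2)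
    (o w : E d) : projSlack T o w (projMap T x) = (T (x, 1)).2⁻¹ * slack o w x := by
  have : (projMap T x, (1 : ℝ)) = (T (x, 1)).2⁻¹ • T (x, 1) := by
    ext1
    · rfl
    · simp [hx.ne']
  rw [projSlack_apply, this, map_smul, T.symm_apply_apply, map_smul, homSlack_one, smul_eq_mul]

theorem PolarPair.eq_zero_of_inner_nonpos {o c : E d} {P Q : Set (E d)} (h : PolarPair o c P Q)
    {z : E d} (hz : ∀ y ∈ vertices Q, inner ℝ (y - c) z ≤ 0) : z = 0 := by
  have hb : Bornology.IsBounded P := by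
    rw [h.left_eq_convexHull, isBounded_convexHull]
    exact h.finite_left.isBounded
  obtain ⟨C, hC⟩ := hb.exists_norm_le
  by_contra hne
  have hn : 0 < ‖z‖ := norm_pos_iff.2 hne
  have hC0 : 0 ≤ C := (norm_nonneg _).trans (hC o h.origin_mem)
  have h1 := hC (o + ((C + ‖o‖ + 1) / ‖z‖) • z) (by
    rw [h.left_eq]
    intro y hy
    rw [add_sub_cancel_left, inner_smul_right]
    have : 0 ≤ (C + ‖o‖ + 1) / ‖z‖ := by positivity
    nlinarith [hz y hy])
  have h2 : ‖((C + ‖o‖ + 1) / ‖z‖) • z‖ = C + ‖o‖ + 1 := by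
    rw [norm_smul, Real.norm_of_nonneg (by positivity)]
    field_simp
  have h3 := norm_sub_norm_le (((C + ‖o‖ + 1) / ‖z‖) • z) (-o)
  rw [h2, sub_neg_eq_add, norm_neg, add_comm _ o] at h3
  linarith

/-- The projective image of `P` is cut out by the transformed facet inequalities of `P`. -/
theorem PolarPair.mem_image_projMap {o c : E d} {P Q : Set (E d)} (h : PolarPair o c P Q)
    (T : (E d × ℝ) ≃ₗ[ℝ] (E d × ℝ)) {z : E d}
    (hz : ∀ y ∈ vertices Q, 0 ≤ projSlack T o (y - c) z) : z ∈ projMap T '' P := by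
  obtain ⟨⟨x, t⟩, hxt⟩ : ∃ p, T.symm (z, 1) = p := ⟨_, rfl⟩
  have hT : T (x, t) = (z, 1) := by rw [← hxt, T.apply_symm_apply]
  have hz' : ∀ y ∈ vertices Q, inner ℝ (y - c) (x - t • o) ≤ t := fun y hy => by
    have := hz y hy
    rw [projSlack_apply, hxt, homSlack_apply] at this
    linarith
  have ht : 0 < t := by
    by_contra! ht
    have h1 := h.eq_zero_of_inner_nonpos fun y hy => (hz' y hy).trans ht
    obtain ⟨y, hy, -⟩ := h.symm.exists_vertex_of_isExposed (IsExposed.refl Q)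
      ⟨c, h.symm.origin_mem⟩
    have h2 := hz' y hy
    rw [h1, inner_zero_right] at h2
    have h3 : t = 0 := le_antisymm ht h2
    rw [h3, zero_smul, sub_zero] at h1
    rw [h1, h3, Prod.mk_zero_zero, map_zero] at hT
    exact zero_ne_one (congrArg Prod.snd hT)
  refine ⟨t⁻¹ • x, ?_, ?_⟩
  · rw [h.left_eq]
    intro y hy
    have : t⁻¹ • x - o = t⁻¹ • (x - t • o) := by
      rw [smul_sub, smul_smul, inv_mul_cancel₀ ht.ne', one_smul]
    rw [this, inner_smul_right, inv_mul_le_iff₀ ht, mul_one]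
    exact hz' y hy
  · have : T (t⁻¹ • x, 1) = t⁻¹ • (z, (1 : ℝ)) := by
      rw [← hT, ← map_smul]
      simp [ht.ne']
    rw [projMap, this]
    simp [smul_smul, ht.ne']

/-! ### The merge -/

/-- The data of a merge of `P` with its polar `Q`. The facets of `P` are denoted by the vertices of
`Q` polar to them: `y₀` stands for the simplex facet with vertices `u k`, and `w k` for the facet
adjacent to it along the ridge omitting `u k`. The permutations `σ` and `τ` of the vertices of
`P` and `Q` respect incidence; `P` is merged with `Q` at the vertex `τ y₀`, whose neighbours are the
`τ (w k)`. -/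
structure MergeSetup (o c : E d) (P Q : Set (E d)) (y₀ : vertices Q) (u : Fin d → vertices P)
    (w : Fin d → vertices Q) (σ : vertices P ≃ vertices P) (τ : vertices Q ≃ vertices Q)
    (T : (E d × ℝ) ≃ₗ[ℝ] (E d × ℝ)) (S : Affine.Simplex ℝ (E d) d) (α : E d ≃ᵃ[ℝ] E d) :
    Prop where
  polar : PolarPair o c P Q
  corner : SimpleCorner o c P Q y₀ (fun k => u k) fun k => w k
  incidence : ∀ x y, inner ℝ ((τ y : E d) - c) ((σ x : E d) - o) = 1 ↔
    inner ℝ ((y : E d) - c) ((x : E d) - o) = 1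
  pos : ∀ x ∈ P, 0 < (T (x, 1)).2
  points_succ : ∀ k, S.points k.succ = projMap T (u k)
  points_zero_mem : ∀ j, S.points 0 ∈ affineSpan ℝ (projMap T '' polarFace o c P (w j))
  image_subset : projMap T '' P ⊆ convexHull ℝ (range S.points)
  map_vertex : α (τ y₀) = S.points 0
  map_neighbour : ∀ k, α (τ (w k)) = S.points k.succ

/-- The simplex facet corresponding to the merged vertex `τ y₀` is in general not the one
corresponding to `y₀`, but the corner configuration is moved along by the permutations. -/
theorem SimpleCorner.map {o c : E d} {P Q : Set (E d)} {y₀ : vertices Q} {u : Fin d → vertices P}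
    {w : Fin d → vertices Q} (hc : SimpleCorner o c P Q y₀ (fun k => u k) fun k => w k)
    {σ : vertices P ≃ vertices P} {τ : vertices Q ≃ vertices Q}
    (hστ : ∀ x y, inner ℝ ((τ y : E d) - c) ((σ x : E d) - o) = 1 ↔
      inner ℝ ((y : E d) - c) ((x : E d) - o) = 1) :
    SimpleCorner o c P Q (τ y₀) (fun k => σ (u k)) fun k => τ (w k) where
  left_mem k := (σ (u k)).2
  mem := (τ y₀).2
  right_mem k := (τ (w k)).2
  tight_iff z hz := by
    obtain ⟨x, hx⟩ := σ.surjective ⟨z, hz⟩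
    have hx' : z = σ x := by rw [hx]
    rw [hx', hστ, hc.tight_iff x x.2, mem_range, mem_range]
    simp only [Subtype.coe_inj, σ.injective.eq_iff]
  tight_neighbour_iff k j := by rw [hστ, hc.tight_neighbour_iff]

namespace MergeSetup

variable {o c : E d} {P Q : Set (E d)} {y₀ : vertices Q} {u : Fin d → vertices P}
  {w : Fin d → vertices Q} {σ : vertices P ≃ vertices P} {τ : vertices Q ≃ vertices Q}
  {T : (E d × ℝ) ≃ₗ[ℝ] (E d × ℝ)} {S : Affine.Simplex ℝ (E d) d} {α : E d ≃ᵃ[ℝ] E d}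

/-- The inequality of the affine image of `Q` that belongs to the point `x` of `P`. -/
noncomputable def affSlack (α : E d ≃ᵃ[ℝ] E d) (c w : E d) : E d →ᵃ[ℝ] ℝ :=
  (slack c w).comp α.symm.toAffineMap

theorem affSlack_apply (α : E d ≃ᵃ[ℝ] E d) (c w y : E d) : affSlack α c w (α y) = slack c w y := by
  simp [affSlack]

theorem mapped_corner (m : MergeSetup o c P Q y₀ u w σ τ T S α) :
    SimpleCorner o c P Q (τ y₀) (fun k => σ (u k)) fun k => τ (w k) :=
  m.corner.map m.incidence

theorem coord_nonneg (m : MergeSetup o c P Q y₀ u w σ τ T S α) {x : E d} (hx : x ∈ P)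
    (i : Fin (d + 1)) : 0 ≤ (simplexBasis S).coord i (projMap T x) := by
  have h1 := m.image_subset (mem_image_of_mem _ hx)
  have h2 := (simplexBasis S).convexHull_eq_nonneg_coord
  change convexHull ℝ (range S.points) = _ at h2
  rw [h2] at h1
  exact h1 i

theorem projSlack_nonneg (m : MergeSetup o c P Q y₀ u w σ τ T S α) {x : E d} (hx : x ∈ P)
    (y : vertices Q) : 0 ≤ projSlack T o ((y : E d) - c) (projMap T x) := by
  rw [projSlack_projMap (m.pos x hx)]
  exact mul_nonneg (inv_nonneg.2 (m.pos x hx).le) (slack_nonneg_iff.2 (m.polar.inner_le hx y.2))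

theorem projSlack_eq_zero_iff (m : MergeSetup o c P Q y₀ u w σ τ T S α) {x : E d} (hx : x ∈ P)
    (y : E d) : projSlack T o (y - c) (projMap T x) = 0 ↔ inner ℝ (y - c) (x - o) = 1 := by
  rw [projSlack_projMap (m.pos x hx), mul_eq_zero, slack_eq_zero_iff]
  exact or_iff_right (inv_ne_zero (m.pos x hx).ne')

theorem projSlack_origin_pos (m : MergeSetup o c P Q y₀ u w σ τ T S α) (y : E d) :
    0 < projSlack T o (y - c) (projMap T o) := by
  have := m.pos o m.polar.origin_mem
  rw [projSlack_projMap this, slack_apply]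
  simpa using this

theorem affSlack_nonneg (m : MergeSetup o c P Q y₀ u w σ τ T S α) {y : E d} (hy : y ∈ Q)
    (x : vertices P) : 0 ≤ affSlack α c ((x : E d) - o) (α y) := by
  rw [affSlack_apply, slack_nonneg_iff]
  exact m.polar.symm.inner_le hy x.2

theorem affSlack_eq_zero_iff (x y : E d) :
    affSlack α c (x - o) (α y) = 0 ↔ inner ℝ (y - c) (x - o) = 1 := by
  rw [affSlack_apply, slack_eq_zero_iff, real_inner_comm]

theorem projSlack_points_succ_nonneg (m : MergeSetup o c P Q y₀ u w σ τ T S α) (y : vertices Q)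
    (k : Fin d) : 0 ≤ projSlack T o ((y : E d) - c) (S.points k.succ) := by
  rw [m.points_succ]
  exact m.projSlack_nonneg ((u k).2.subset rfl) y

theorem affSlack_points_nonneg (m : MergeSetup o c P Q y₀ u w σ τ T S α) (x : vertices P)
    (i : Fin (d + 1)) : 0 ≤ affSlack α c ((x : E d) - o) (S.points i) := by
  refine Fin.cases ?_ (fun k => ?_) i
  · rw [← m.map_vertex]
    exact m.affSlack_nonneg ((τ y₀).2.subset rfl) x
  · rw [← m.map_neighbour]
    exact m.affSlack_nonneg ((τ (w k)).2.subset rfl) x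

theorem projSlack_base (m : MergeSetup o c P Q y₀ u w σ τ T S α) (z : E d) :
    projSlack T o ((y₀ : E d) - c) z =
      (simplexBasis S).coord 0 z * projSlack T o ((y₀ : E d) - c) (S.points 0) := by
  refine apply_eq_coord_mul 0 (fun j => Fin.cases (fun h => absurd rfl h) (fun k _ => ?_) j) z
  rw [m.points_succ, m.projSlack_eq_zero_iff ((u k).2.subset rfl)]
  exact m.corner.tight k

theorem projSlack_base_pos (m : MergeSetup o c P Q y₀ u w σ τ T S α) :
    0 < projSlack T o ((y₀ : E d) - c) (S.points 0) := by
  have h1 := m.projSlack_origin_pos (y₀ : E d)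
  rw [m.projSlack_base] at h1
  exact pos_of_mul_pos_right h1 (m.coord_nonneg m.polar.origin_mem 0)

theorem projSlack_adjacent (m : MergeSetup o c P Q y₀ u w σ τ T S α) (k : Fin d) (z : E d) :
    projSlack T o ((w k : E d) - c) z = (simplexBasis S).coord k.succ z *
      projSlack T o ((w k : E d) - c) (S.points k.succ) := by
  refine apply_eq_coord_mul k.succ (fun j => Fin.cases (fun _ => ?_) (fun j hj => ?_) j) z
  · refine eq_zero_of_mem_affineSpan ?_ (m.points_zero_mem k)
    rintro _ ⟨x, hx, rfl⟩
    exact (m.projSlack_eq_zero_iff hx.1 _).2 hx.2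
  · rw [m.points_succ, m.projSlack_eq_zero_iff ((u j).2.subset rfl)]
    exact (m.corner.tight_neighbour_iff k j).2 fun H => hj (H ▸ rfl)

theorem projSlack_adjacent_pos (m : MergeSetup o c P Q y₀ u w σ τ T S α) (k : Fin d) :
    0 < projSlack T o ((w k : E d) - c) (S.points k.succ) := by
  refine lt_of_le_of_ne (m.projSlack_points_succ_nonneg _ k) fun H => ?_
  rw [m.points_succ, eq_comm, m.projSlack_eq_zero_iff ((u k).2.subset rfl)] at H
  exact (m.corner.tight_neighbour_iff k k).1 H rfl

theorem affSlack_adjacent (m : MergeSetup o c P Q y₀ u w σ τ T S α) (k : Fin d) (z : E d) :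
    affSlack α c ((σ (u k) : E d) - o) z = (simplexBasis S).coord k.succ z *
      affSlack α c ((σ (u k) : E d) - o) (S.points k.succ) := by
  refine apply_eq_coord_mul k.succ (fun j => Fin.cases (fun _ => ?_) (fun j hj => ?_) j) z
  · rw [← m.map_vertex, affSlack_eq_zero_iff]
    exact m.mapped_corner.tight k
  · rw [← m.map_neighbour, affSlack_eq_zero_iff]
    exact (m.mapped_corner.tight_neighbour_iff j k).2 fun H => hj (H ▸ rfl)

theorem affSlack_adjacent_pos (m : MergeSetup o c P Q y₀ u w σ τ T S α) (k : Fin d) :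
    0 < affSlack α c ((σ (u k) : E d) - o) (S.points k.succ) := by
  refine lt_of_le_of_ne (m.affSlack_points_nonneg _ _) fun H => ?_
  rw [← m.map_neighbour, eq_comm, affSlack_eq_zero_iff] at H
  exact (m.mapped_corner.tight_neighbour_iff k k).1 H rfl

theorem coord_succ_nonneg_iff (m : MergeSetup o c P Q y₀ u w σ τ T S α) (k : Fin d) (z : E d) :
    0 ≤ (simplexBasis S).coord k.succ z ↔ 0 ≤ affSlack α c ((σ (u k) : E d) - o) z := by
  rw [m.affSlack_adjacent]
  exact (mul_nonneg_iff_of_pos_right (m.affSlack_adjacent_pos k)).symm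

theorem affSlack_apex_pos (m : MergeSetup o c P Q y₀ u w σ τ T S α) {x : vertices P}
    (hx : x ∉ range u) : 0 < affSlack α c ((σ x : E d) - o) (S.points 0) := by
  refine lt_of_le_of_ne (m.affSlack_points_nonneg _ _) fun H => hx ?_
  rw [← m.map_vertex, eq_comm, affSlack_eq_zero_iff, m.incidence, m.corner.tight_iff _ x.2] at H
  obtain ⟨k, hk⟩ := H
  exact ⟨k, Subtype.ext hk⟩

theorem coord_zero_projMap_pos (m : MergeSetup o c P Q y₀ u w σ τ T S α) {x : E d} (hx : x ∈ P)
    (hxy : inner ℝ ((y₀ : E d) - c) (x - o) ≠ 1) :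
    0 < (simplexBasis S).coord 0 (projMap T x) := by
  refine lt_of_le_of_ne (m.coord_nonneg hx 0) fun H => hxy ?_
  rw [← m.projSlack_eq_zero_iff hx, m.projSlack_base, ← H, zero_mul]

/-- Every facet of the transformed `P` other than the base and its adjacent facets has the apex of
the simplex strictly on its outer side: otherwise it would be contained in a facet of the simplex.
-/
theorem projSlack_apex_neg (m : MergeSetup o c P Q y₀ u w σ τ T S α) {y : vertices Q}
    (hy₀ : y ≠ y₀) (hy : y ∉ range w) : projSlack T o ((y : E d) - c) (S.points 0) < 0 := by
  by_contra! h0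
  have hnn : ∀ i, 0 ≤ projSlack T o ((y : E d) - c) (S.points i) :=
    fun i => Fin.cases h0 (m.projSlack_points_succ_nonneg y) i
  obtain ⟨i, hi⟩ : ∃ i, projSlack T o ((y : E d) - c) (S.points i) ≠ 0 := by
    by_contra! H
    have := m.projSlack_origin_pos (y : E d)
    rw [apply_eq_sum_coord S] at this
    simp [H] at this
  have hcoord : ∀ x ∈ polarFace o c P y, (simplexBasis S).coord i (projMap T x) = 0 := fun x hx =>
    (coord_eq_zero_or (m.coord_nonneg hx.1) hnn ((m.projSlack_eq_zero_iff hx.1 _).2 hx.2)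
      i).resolve_right hi
  revert hcoord
  refine Fin.cases (fun hcoord => ?_) (fun k hcoord => ?_) i
  · refine hy₀ (Subtype.ext (m.polar.eq_of_polarFace_subset y.2 (z := y₀) ?_).symm)
    intro x hx
    refine ⟨hx.1, (m.projSlack_eq_zero_iff hx.1 _).1 ?_⟩
    rw [m.projSlack_base, hcoord x hx, zero_mul]
  · refine hy ⟨k, Subtype.ext (m.polar.eq_of_polarFace_subset y.2 (z := w k) ?_)⟩
    intro x hx
    refine ⟨hx.1, (m.projSlack_eq_zero_iff hx.1 _).1 ?_⟩
    rw [m.projSlack_adjacent, hcoord x hx, zero_mul]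

theorem projSlack_apex_nonpos (m : MergeSetup o c P Q y₀ u w σ τ T S α) {y : vertices Q}
    (hy₀ : y ≠ y₀) : projSlack T o ((y : E d) - c) (S.points 0) ≤ 0 := by
  by_cases hy : y ∈ range w
  · obtain ⟨k, rfl⟩ := hy
    rw [m.projSlack_adjacent, ← simplexBasis_apply,
      (simplexBasis S).coord_apply_ne (Fin.succ_ne_zero k), zero_mul]
  · exact (m.projSlack_apex_neg hy₀ hy).le

theorem coord_succ_map_nonneg (m : MergeSetup o c P Q y₀ u w σ τ T S α) {y : E d} (hy : y ∈ Q)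
    (k : Fin d) : 0 ≤ (simplexBasis S).coord k.succ (α y) := by
  rw [m.coord_succ_nonneg_iff]
  exact m.affSlack_nonneg hy _

/-- The vertices of the transformed `Q` other than the merged vertex and its neighbours lie strictly
beyond the base of the simplex: otherwise they would lie in the simplex, all of whose vertices belong
to the transformed `Q`. -/
theorem coord_zero_map_neg (m : MergeSetup o c P Q y₀ u w σ τ T S α) {y : vertices Q}
    (hy₀ : y ≠ y₀) (hy : y ∉ range w) : (simplexBasis S).coord 0 (α (τ y)) < 0 := by
  by_contra! h0
  have hyQ : (τ y : E d) ∈ Q := (τ y).2.subset rfl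
  have hnn : ∀ i, 0 ≤ (simplexBasis S).coord i (α (τ y)) :=
    fun i => Fin.cases h0 (m.coord_succ_map_nonneg hyQ) i
  obtain ⟨i, hi⟩ : ∃ i, (simplexBasis S).coord i (α (τ y)) ≠ 0 := by
    by_contra! H
    have := (simplexBasis S).sum_coord_apply_eq_one (α (τ y))
    simp [H] at this
  have hcoord : ∀ x : vertices P, inner ℝ ((τ y : E d) - c) ((x : E d) - o) = 1 →
      affSlack α c ((x : E d) - o) (S.points i) = 0 := fun x hx =>
    (coord_eq_zero_or hnn (m.affSlack_points_nonneg x)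
      ((affSlack_eq_zero_iff _ _).2 hx) i).resolve_left hi
  revert hcoord
  refine Fin.cases (fun hcoord => ?_) (fun k hcoord => ?_) i
  · refine hy₀ (τ.injective (Subtype.ext (m.polar.eq_of_tight (τ y).2 fun x hx hxy => ?_).symm))
    have := hcoord ⟨x, hx⟩ hxy
    rwa [← m.map_vertex, affSlack_eq_zero_iff] at this
  · refine hy ⟨k, τ.injective (Subtype.ext (m.polar.eq_of_tight (τ y).2 fun x hx hxy => ?_))⟩
    have := hcoord ⟨x, hx⟩ hxy
    rwa [← m.map_neighbour, affSlack_eq_zero_iff] at this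

theorem coord_zero_map_nonpos (m : MergeSetup o c P Q y₀ u w σ τ T S α) {y : vertices Q}
    (hy₀ : y ≠ y₀) : (simplexBasis S).coord 0 (α (τ y)) ≤ 0 := by
  by_cases hy : y ∈ range w
  · obtain ⟨k, rfl⟩ := hy
    rw [m.map_neighbour, ← simplexBasis_apply,
      (simplexBasis S).coord_apply_ne (Fin.succ_ne_zero k).symm]
  · exact (m.coord_zero_map_neg hy₀ hy).le

theorem ne_base (m : MergeSetup o c P Q y₀ u w σ τ T S α) (k : Fin d) : w k ≠ y₀ := fun H =>
  m.corner.ne k (congrArg Subtype.val H)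

/-- The points spanning the merge: the images of the vertices of `P` outside the base and of the
vertices of `Q` other than the merged one. The vertices of the base are among the latter. -/
noncomputable def point (T : (E d × ℝ) ≃ₗ[ℝ] (E d × ℝ)) (α : E d ≃ᵃ[ℝ] E d)
    (u : Fin d → vertices P) (y₀ : vertices Q) (τ : vertices Q ≃ vertices Q) :
    {x : vertices P // x ∉ range u} ⊕ {y : vertices Q // y ≠ y₀} → E d :=
  Sum.elim (fun x => projMap T x.1) fun y => α (τ y.1)

/-- The inequalities cutting out the merge, indexed by the same type as the points. The shifts by `σ`
here and by `τ` in `point` are chosen such that incidence becomes symmetric. -/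
noncomputable def ineq (T : (E d × ℝ) ≃ₗ[ℝ] (E d × ℝ)) (α : E d ≃ᵃ[ℝ] E d) (o c : E d)
    (u : Fin d → vertices P) (y₀ : vertices Q) (σ : vertices P ≃ vertices P) :
    {x : vertices P // x ∉ range u} ⊕ {y : vertices Q // y ≠ y₀} → E d →ᵃ[ℝ] ℝ :=
  Sum.elim (fun x => affSlack α c ((σ x.1 : E d) - o)) fun y => projSlack T o ((y.1 : E d) - c)

theorem convexHull_subset_right (m : MergeSetup o c P Q y₀ u w σ τ T S α) :
    convexHull ℝ (vertices Q \ {(τ y₀ : E d)}) ⊆ Q := by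
  conv_rhs => rw [m.polar.right_eq_convexHull]
  exact convexHull_mono sdiff_subset

theorem coord_zero_nonpos (m : MergeSetup o c P Q y₀ u w σ τ T S α) {y : E d}
    (hy : y ∈ convexHull ℝ (vertices Q \ {(τ y₀ : E d)})) :
    (simplexBasis S).coord 0 (α y) ≤ 0 := by
  have hconv : Convex ℝ (((simplexBasis S).coord 0).comp α.toAffineMap ⁻¹' Iic 0) :=
    (convex_Iic (0 : ℝ)).affine_preimage _
  refine convexHull_min ?_ hconv hy
  rintro z ⟨hz, hzv⟩
  obtain ⟨y, hy⟩ := τ.surjective ⟨z, hz⟩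
  have hzy : z = τ y := by rw [hy]
  rw [hzy] at hzv ⊢
  exact m.coord_zero_map_nonpos fun H => hzv (by rw [H]; rfl)

theorem points_succ_mem (m : MergeSetup o c P Q y₀ u w σ τ T S α) (k : Fin d) :
    S.points k.succ ∈ α '' convexHull ℝ (vertices Q \ {(τ y₀ : E d)}) := by
  rw [← m.map_neighbour]
  refine mem_image_of_mem _ (subset_convexHull ℝ _ ⟨(τ (w k)).2, fun H => ?_⟩)
  exact m.ne_base k (τ.injective (Subtype.ext H))

/-- Removing the merged vertex from `Q` cuts off exactly the part on the inner side of the base. -/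
theorem mem_image_convexHull [NeZero d] (m : MergeSetup o c P Q y₀ u w σ τ T S α) {y : E d}
    (hy : y ∈ Q) (h0 : (simplexBasis S).coord 0 (α y) < 0) :
    α y ∈ α '' convexHull ℝ (vertices Q \ {(τ y₀ : E d)}) := by
  set D := α '' convexHull ℝ (vertices Q \ {(τ y₀ : E d)}) with hD
  have hDc : Convex ℝ D := (convex_convexHull ℝ _).affine_image α.toAffineMap
  have hQ : Q = convexHull ℝ (insert (τ y₀ : E d) (vertices Q \ {(τ y₀ : E d)})) := by
    rw [insert_sdiff_singleton, insert_eq_of_mem (τ y₀).2]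
    exact m.polar.right_eq_convexHull
  have hne : (vertices Q \ {(τ y₀ : E d)}).Nonempty :=
    convexHull_nonempty_iff.1 ((m.points_succ_mem 0).imp fun _ h => h.1)
  have hy' := hy
  rw [hQ, convexHull_insert hne, mem_convexJoin] at hy'
  obtain ⟨_, rfl, b, hb, hyb⟩ := hy'
  have hbQ : b ∈ Q := m.convexHull_subset_right hb
  have hQc : Convex ℝ Q := by rw [m.polar.right_eq_convexHull]; exact convex_convexHull ℝ _
  have hcoord : ∀ r : ℝ, (simplexBasis S).coord 0 (α (AffineMap.lineMap (τ y₀ : E d) b r)) =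
      1 - r + r * (simplexBasis S).coord 0 (α b) := by
    intro r
    have : (simplexBasis S).coord 0 (α (τ y₀)) = 1 := by
      rw [m.map_vertex, ← simplexBasis_apply, (simplexBasis S).coord_apply_eq]
    rw [AffineEquiv.apply_lineMap, AffineMap.apply_lineMap, AffineMap.lineMap_apply_module, this]
    simp
  rw [segment_eq_image_lineMap] at hyb
  obtain ⟨t, ⟨ht0, ht1⟩, rfl⟩ := hyb
  set β := -(simplexBasis S).coord 0 (α b) with hβ
  have hβ0 : 0 ≤ β := neg_nonneg.2 (m.coord_zero_nonpos hb)
  rw [hcoord] at h0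
  have hβ1 : 0 < β := by
    refine lt_of_le_of_ne hβ0 fun H => ?_
    rw [show (simplexBasis S).coord 0 (α b) = 0 by linarith] at h0
    linarith
  -- `e` is the point where the segment from the merged vertex to `b` meets the base
  set e := AffineMap.lineMap (τ y₀ : E d) b (1 / (1 + β)) with he
  have heQ : e ∈ Q := hQc.lineMap_mem ((τ y₀).2.subset rfl) hbQ
    ⟨by positivity, by rw [div_le_one (by positivity)]; linarith⟩
  have he0 : (simplexBasis S).coord 0 (α e) = 0 := by
    rw [he, hcoord, show (simplexBasis S).coord 0 (α b) = -β by rw [hβ, neg_neg]]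
    field_simp
    ring
  have heD : α e ∈ D := by
    have h1 := (simplexBasis S).linear_combination_coord_eq_self (α e)
    have h2 := (simplexBasis S).sum_coord_apply_eq_one (α e)
    rw [Fin.sum_univ_succ, he0] at h1 h2
    rw [zero_smul, zero_add] at h1
    rw [zero_add] at h2
    rw [← h1]
    exact hDc.sum_mem (fun k _ => m.coord_succ_map_nonneg heQ k) h2 fun k _ => m.points_succ_mem k
  have hmu : AffineMap.lineMap (τ y₀ : E d) b t =
      AffineMap.lineMap b e ((1 - t) * (1 + β) / β) := by
    rw [he]
    simp only [AffineMap.lineMap_apply_module]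
    match_scalars <;> field_simp <;> ring
  rw [hmu, AffineEquiv.apply_lineMap]
  refine hDc.lineMap_mem (mem_image_of_mem _ hb) heD ⟨?_, ?_⟩
  · exact div_nonneg (mul_nonneg (by linarith) (by linarith)) hβ0
  · rw [div_le_one hβ1]
    rw [show (simplexBasis S).coord 0 (α b) = -β by rw [hβ, neg_neg]] at h0
    nlinarith

/-- The merge is cut out by the facet inequalities of the two transformed polytopes, except those of
the base facet and those of the facets at the merged vertex. -/
theorem eq_setOf [NeZero d] (m : MergeSetup o c P Q y₀ u w σ τ T S α) :
    projMap T '' P ∪ α '' convexHull ℝ (vertices Q \ {(τ y₀ : E d)}) =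
      {z | ∀ n, 0 ≤ ineq T α o c u y₀ σ n z} := by
  apply Subset.antisymm
  · rintro z (⟨x, hx, rfl⟩ | ⟨y, hy, rfl⟩) (⟨x', hx'⟩ | ⟨y', hy'⟩)
    · simp only [ineq, Sum.elim_inl]
      rw [apply_eq_sum_coord S]
      exact Finset.sum_nonneg fun i _ =>
        mul_nonneg (m.coord_nonneg hx i) (m.affSlack_points_nonneg _ i)
    · exact m.projSlack_nonneg hx y'
    · exact m.affSlack_nonneg (m.convexHull_subset_right hy) _
    · simp only [ineq, Sum.elim_inr]
      rw [apply_eq_sum_coord S, Fin.sum_univ_succ]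
      refine add_nonneg (mul_nonneg_of_nonpos_of_nonpos (m.coord_zero_nonpos hy)
        (m.projSlack_apex_nonpos hy')) (Finset.sum_nonneg fun k _ => mul_nonneg
          (m.coord_succ_map_nonneg (m.convexHull_subset_right hy) k)
          (m.projSlack_points_succ_nonneg _ k))
  · intro z hz
    have hproj : ∀ y : vertices Q, y ≠ y₀ → 0 ≤ projSlack T o ((y : E d) - c) z :=
      fun y hy => hz (Sum.inr ⟨y, hy⟩)
    rcases le_or_gt 0 ((simplexBasis S).coord 0 z) with h0 | h0
    · refine Or.inl (m.polar.mem_image_projMap T fun y hy => ?_)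
      by_cases hyy : (⟨y, hy⟩ : vertices Q) = y₀
      · have : y = y₀ := congrArg Subtype.val hyy
        rw [this, m.projSlack_base]
        exact mul_nonneg h0 m.projSlack_base_pos.le
      · exact hproj ⟨y, hy⟩ hyy
    · right
      obtain ⟨y, rfl⟩ := α.surjective z
      refine m.mem_image_convexHull ?_ h0
      rw [m.polar.right_eq]
      intro x hx
      obtain ⟨x', hx'⟩ := σ.surjective ⟨x, hx⟩
      have hxx : x = σ x' := by rw [hx']
      have key : 0 ≤ affSlack α c ((σ x' : E d) - o) (α y) := by
        by_cases hu : x' ∈ range u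
        · obtain ⟨k, rfl⟩ := hu
          have h1 := hproj (w k) (m.ne_base k)
          rw [m.projSlack_adjacent] at h1
          rw [← m.coord_succ_nonneg_iff]
          exact (mul_nonneg_iff_of_pos_right (m.projSlack_adjacent_pos k)).1 h1
        · exact hz (Sum.inl ⟨x', hu⟩)
      rw [affSlack_apply, slack_nonneg_iff, real_inner_comm] at key
      rw [hxx]
      exact key

theorem eq_convexHull [NeZero d] (m : MergeSetup o c P Q y₀ u w σ τ T S α) :
    projMap T '' P ∪ α '' convexHull ℝ (vertices Q \ {(τ y₀ : E d)}) =
      convexHull ℝ (range (point T α u y₀ τ)) := by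
  have hright : ∀ y : vertices Q, y ≠ y₀ → α (τ y) ∈ range (point T α u y₀ τ) :=
    fun y hy => ⟨Sum.inr ⟨y, hy⟩, rfl⟩
  apply Subset.antisymm
  · refine union_subset ?_ ?_
    · conv_lhs => rw [m.polar.left_eq_convexHull]
      refine (projMap_image_convexHull_subset fun x hx => m.pos x (hx.subset rfl)).trans
        (convexHull_mono ?_)
      rintro _ ⟨x, hx, rfl⟩
      by_cases hu : (⟨x, hx⟩ : vertices P) ∈ range u
      · obtain ⟨k, hk⟩ := hu
        have : x = u k := by rw [hk]
        rw [this, ← m.points_succ, ← m.map_neighbour]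
        exact hright _ (m.ne_base k)
      · exact ⟨Sum.inl ⟨⟨x, hx⟩, hu⟩, rfl⟩
    · have himage : α '' convexHull ℝ (vertices Q \ {(τ y₀ : E d)}) =
          convexHull ℝ (α '' (vertices Q \ {(τ y₀ : E d)})) :=
        α.toAffineMap.image_convexHull _
      rw [himage]
      refine convexHull_mono ?_
      rintro _ ⟨y, ⟨hy, hyv⟩, rfl⟩
      obtain ⟨y', hy'⟩ := τ.surjective ⟨y, hy⟩
      have : y = τ y' := by rw [hy']
      rw [this] at hyv ⊢
      exact hright y' fun H => hyv (by rw [H]; rfl)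
  · have hconv : Convex ℝ {z | ∀ n, 0 ≤ ineq T α o c u y₀ σ n z} := by
      rw [ofPred_forall]
      exact convex_iInter fun n => (convex_Ici (𝕜 := ℝ) (0 : ℝ)).affine_preimage _
    rw [← m.eq_setOf] at hconv
    refine convexHull_min ?_ hconv
    rintro _ ⟨⟨x, hx⟩ | ⟨y, hy⟩, rfl⟩
    · exact Or.inl (mem_image_of_mem _ (x.2.subset rfl))
    · refine Or.inr (mem_image_of_mem _ (subset_convexHull ℝ _ ⟨(τ y).2, fun H => hy ?_⟩))
      exact τ.injective (Subtype.ext H)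

theorem doubleDescription [NeZero d] (m : MergeSetup o c P Q y₀ u w σ τ T S α) :
    DoubleDescription (projMap T '' P ∪ α '' convexHull ℝ (vertices Q \ {(τ y₀ : E d)}))
      (point T α u y₀ τ) (ineq T α o c u y₀ σ) := by
  refine ⟨m.eq_convexHull, m.eq_setOf, projMap T o, ?_⟩
  rintro (⟨x, hx⟩ | ⟨y, hy⟩)
  · simp only [ineq, Sum.elim_inl]
    rw [apply_eq_sum_coord S, Fin.sum_univ_succ]
    refine add_pos_of_pos_of_nonneg (mul_pos (m.coord_zero_projMap_pos m.polar.origin_mem (by simp))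
      (m.affSlack_apex_pos hx)) (Finset.sum_nonneg fun k _ =>
        mul_nonneg (m.coord_nonneg m.polar.origin_mem _) (m.affSlack_points_nonneg _ _))
  · exact m.projSlack_origin_pos y

/-- Incidence with an inequality of an adjacent facet, in terms of the original polytopes. -/
theorem projSlack_adjacent_eq_zero_iff (m : MergeSetup o c P Q y₀ u w σ τ T S α) (k : Fin d)
    (y : vertices Q) : projSlack T o ((w k : E d) - c) (α (τ y)) = 0 ↔
      inner ℝ ((y : E d) - c) ((u k : E d) - o) = 1 := by
  rw [← m.incidence, ← affSlack_eq_zero_iff (α := α), m.affSlack_adjacent, m.projSlack_adjacent,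
    mul_eq_zero_iff_right (m.projSlack_adjacent_pos k).ne',
    mul_eq_zero_iff_right (m.affSlack_adjacent_pos k).ne']

theorem projSlack_neighbour_eq_zero_iff (m : MergeSetup o c P Q y₀ u w σ τ T S α) (k : Fin d)
    (y : vertices Q) : projSlack T o ((y : E d) - c) (α (τ (w k))) = 0 ↔
      inner ℝ ((y : E d) - c) ((u k : E d) - o) = 1 := by
  rw [m.map_neighbour, m.points_succ, m.projSlack_eq_zero_iff ((u k).2.subset rfl)]

theorem affSlack_projMap_ne_zero (m : MergeSetup o c P Q y₀ u w σ τ T S α) {x x' : vertices P}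
    (hx : x ∉ range u) (hx' : x' ∉ range u) :
    affSlack α c ((σ x' : E d) - o) (projMap T x) ≠ 0 := by
  intro H
  have hxP : (x : E d) ∈ P := x.2.subset rfl
  rcases coord_eq_zero_or (m.coord_nonneg hxP) (m.affSlack_points_nonneg _) H 0 with h | h
  · refine (m.coord_zero_projMap_pos hxP fun hxy => hx ?_).ne' h
    obtain ⟨k, hk⟩ := (m.corner.tight_iff _ x.2).1 hxy
    exact ⟨k, Subtype.ext hk⟩
  · exact (m.affSlack_apex_pos hx').ne' h

theorem projSlack_map_ne_zero (m : MergeSetup o c P Q y₀ u w σ τ T S α) {y y' : vertices Q}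
    (hy₀ : y ≠ y₀) (hy₀' : y' ≠ y₀) (hy : y ∉ range w) (hy' : y' ∉ range w) :
    projSlack T o ((y' : E d) - c) (α (τ y)) ≠ 0 := by
  rw [apply_eq_sum_coord S, Fin.sum_univ_succ]
  exact (add_pos_of_pos_of_nonneg (mul_pos_of_neg_of_neg (m.coord_zero_map_neg hy₀ hy)
    (m.projSlack_apex_neg hy₀' hy')) (Finset.sum_nonneg fun k _ => mul_nonneg
      (m.coord_succ_map_nonneg ((τ y).2.subset rfl) k)
      (m.projSlack_points_succ_nonneg _ k))).ne'

theorem incidence_symm (m : MergeSetup o c P Q y₀ u w σ τ T S α)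
    (n n' : {x : vertices P // x ∉ range u} ⊕ {y : vertices Q // y ≠ y₀}) :
    ineq T α o c u y₀ σ n' (point T α u y₀ τ n) = 0 ↔
      ineq T α o c u y₀ σ n (point T α u y₀ τ n') = 0 := by
  have mixed : ∀ (x : vertices P) (y : vertices Q),
      projSlack T o ((y : E d) - c) (projMap T x) = 0 ↔
        affSlack α c ((σ x : E d) - o) (α (τ y)) = 0 := fun x y => by
    rw [m.projSlack_eq_zero_iff (x.2.subset rfl), affSlack_eq_zero_iff, m.incidence]
  rcases n with ⟨x, hx⟩ | ⟨y, hy⟩ <;> rcases n' with ⟨x', hx'⟩ | ⟨y', hy'⟩ <;>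
    simp only [ineq, point, Sum.elim_inl, Sum.elim_inr]
  · exact iff_of_false (m.affSlack_projMap_ne_zero hx hx') (m.affSlack_projMap_ne_zero hx' hx)
  · exact mixed x y'
  · exact (mixed x' y).symm
  · by_cases h : y ∈ range w
    · obtain ⟨k, rfl⟩ := h
      rw [m.projSlack_adjacent_eq_zero_iff, m.projSlack_neighbour_eq_zero_iff]
    · by_cases h' : y' ∈ range w
      · obtain ⟨k, rfl⟩ := h'
        rw [m.projSlack_adjacent_eq_zero_iff, m.projSlack_neighbour_eq_zero_iff]
      · exact iff_of_false (m.projSlack_map_ne_zero hy hy' h h') (m.projSlack_map_ne_zero hy' hy h' h)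

theorem isPolytope [NeZero d] (m : MergeSetup o c P Q y₀ u w σ τ T S α) :
    IsPolytope (projMap T '' P ∪ α '' convexHull ℝ (vertices Q \ {(τ y₀ : E d)})) := by
  have : Finite (vertices P) := m.polar.finite_left
  have : Finite (vertices Q) := m.polar.finite_right
  refine ⟨⟨(finite_range (point T α u y₀ τ)).toFinset, ?_⟩, ?_⟩
  · rw [Finite.coe_toFinset]
    exact m.eq_convexHull
  · rw [eq_top_iff, ← S.span_eq_top (by simp)]
    refine affineSpan_le.2 ?_
    rintro _ ⟨i, rfl⟩
    refine Fin.cases ?_ (fun k => ?_) i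
    · exact affineSpan_mono ℝ ((image_mono fun x hx => hx.1).trans subset_union_left)
        (m.points_zero_mem 0)
    · exact subset_affineSpan ℝ _ (Or.inr (m.points_succ_mem k))

theorem isSelfDual [NeZero d] (m : MergeSetup o c P Q y₀ u w σ τ T S α) :
    IsSelfDual (projMap T '' P ∪ α '' convexHull ℝ (vertices Q \ {(τ y₀ : E d)})) := by
  have : Finite (vertices P) := m.polar.finite_left
  have : Finite (vertices Q) := m.polar.finite_right
  intro o' ho'
  obtain ⟨e⟩ := (m.isPolytope.polarPair ho').nonempty_face_orderIso
  obtain ⟨f⟩ := m.doubleDescription.nonempty_orderIso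
  have hr : Function.swap (fun n n' => ineq T α o c u y₀ σ n' (point T α u y₀ τ n) = 0) =
      fun n n' => ineq T α o c u y₀ σ n' (point T α u y₀ τ n) = 0 := by
    funext n n'
    exact propext (m.incidence_symm n' n)
  have s := Concept.swapEquiv (r := fun n n' => ineq T α o c u y₀ σ n' (point T α u y₀ τ n) = 0)
  rw [hr] at s
  exact ⟨((f.trans s.symm).trans f.symm.dual).trans (e.dual.trans (OrderIso.dualDual _).symm)⟩

end MergeSetup

/-! ### Simplex facets -/

theorem mem_convexHull_image_iff {u : Fin d → E d} (hu : AffineIndependent ℝ u) {j k : Fin d} :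
    u j ∈ convexHull ℝ (u '' {l | l ≠ k}) ↔ j ≠ k := by
  refine ⟨fun h => ?_, fun h => subset_convexHull ℝ _ (mem_image_of_mem u h)⟩
  rintro rfl
  exact (hu.mem_affineSpan_iff j _).1 (convexHull_subset_affineSpan _ h) rfl

/-- The vertices of `P` on a face that is a simplex are the vertices of the simplex. -/
theorem vertices_inter_convexHull {o c : E d} {P Q : Set (E d)} (h : PolarPair o c P Q)
    {u : Fin d → E d} (hu : AffineIndependent ℝ u)
    (hF : IsExposed ℝ P (convexHull ℝ (range u))) :
    vertices P ∩ convexHull ℝ (range u) = range u := by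
  have hsub : vertices P ∩ convexHull ℝ (range u) ⊆ range u := by
    rintro x ⟨hx, hxF⟩
    rw [h.vertices_eq] at hx
    exact extremePoints_convexHull_subset
      (inter_extremePoints_subset_extremePoints_of_subset hF.subset ⟨hxF, hx⟩)
  refine hsub.antisymm ?_
  rintro _ ⟨k, rfl⟩
  refine ⟨?_, subset_convexHull ℝ _ (mem_range_self k)⟩
  by_contra hk
  have h1 := subset_convexHull_of_isExposed h.left_eq_convexHull hF
    (subset_convexHull ℝ _ (mem_range_self k))
  refine (mem_convexHull_image_iff hu (j := k) (k := k)).1 (convexHull_mono ?_ h1) rfl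
  intro x hx
  obtain ⟨j, rfl⟩ := hsub hx
  refine ⟨j, ?_, rfl⟩
  rintro rfl
  exact hk hx.1

/-- Dually, a simplex facet with its adjacent facets is a simple vertex with its neighbours. -/
theorem simpleCorner_of_adjacentFacets {o c : E d} {P Q : Set (E d)} (h : PolarPair o c P Q)
    {u : Fin d → E d} (hu : AffineIndependent ℝ u)
    (hF : IsExposed ℝ P (convexHull ℝ (range u))) {y : E d} (hy : y ∈ vertices Q)
    (hFy : convexHull ℝ (range u) = polarFace o c P y) {w : Fin d → E d}
    (hw : ∀ k, w k ∈ vertices Q) (hH : AdjacentFacets P u fun k => polarFace o c P (w k)) :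
    SimpleCorner o c P Q y u w := by
  have hv := vertices_inter_convexHull h hu hF
  have huP : ∀ k, u k ∈ vertices P ∩ convexHull ℝ (range u) := fun k =>
    hv.symm.subset (mem_range_self k)
  refine ⟨fun k => (huP k).1, hy, hw, fun z hz => ?_, fun k j => ?_⟩
  · rw [← hv, hFy]
    exact ⟨fun H => ⟨hz, hz.subset rfl, H⟩, fun H => H.2.2⟩
  · rw [← mem_convexHull_image_iff hu (k := k), ← (hH k).2]
    exact ⟨fun H => ⟨⟨(huP j).1.subset rfl, H⟩, (huP j).2⟩, fun H => H.1.2⟩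

end Polytope

open Polytope
theorem proposition5p3 (i : ℕ) (hi : 1 ≤ i) (P : Set (E (2 * i))) (hP : IsPolytope P)
    (hsimplicial : IsSimplicial i P) (hsimple : IsSimple i P)
    (o : E (2 * i)) (ho : o ∈ interior P)
    (u : Fin (2 * i) → E (2 * i)) (hu : AffineIndependent ℝ u)
    (hF : IsFacet P (convexHull ℝ (Set.range u)))
    (H : Fin (2 * i) → Set (E (2 * i))) (hH : AdjacentFacets P u H) :
    Nonempty (Face P ≃o (Face (dual o P))ᵒᵈ) ∧
    ∀ φ : Face P ≃o (Face (dual o P))ᵒᵈ,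
      ∃ (v : E (2 * i)) (u' : Fin (2 * i) → E (2 * i)),
        (OrderDual.ofDual (φ ⟨convexHull ℝ (Set.range u), hF.isExposed⟩)).1 = {v} ∧
        (∀ k, (OrderDual.ofDual (φ ⟨H k, (hH k).1.isExposed⟩)).1 = {u' k}) ∧
        (∃ M, IsMerge P u H (dual o P) v u' M) ∧
        ∀ M, IsMerge P u H (dual o P) v u' M → IsPolytope M ∧ IsSelfDual M := by
  have : NeZero (2 * i) := ⟨by omega⟩
  have h : PolarPair o 0 P (dual o P) := hP.polarPair ho
  refine ⟨h.nonempty_face_orderIso, fun φ => ?_⟩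
  obtain ⟨σ, τ, hτ, hστ⟩ := h.exists_relabelling φ
  have facet_iff := fun {F} => h.isFacet_iff hP.affineSpan_eq_top (F := F)
  obtain ⟨y₀, hy₀, hFy⟩ := facet_iff.1 hF
  have hw : ∀ k, ∃ w : vertices (dual o P), H k = polarFace o 0 P w := fun k => by
    obtain ⟨w, hw, hHw⟩ := facet_iff.1 (hH k).1
    exact ⟨⟨w, hw⟩, hHw⟩
  choose w hw using hw
  obtain rfl : H = fun k => polarFace o 0 P (w k) := funext hw
  have hc := simpleCorner_of_adjacentFacets h hu hF.isExposed hy₀ hFy (fun k => (w k).2) hH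
  let us : Fin (2 * i) → vertices P := fun k => ⟨u k, hc.left_mem k⟩
  let y : vertices (dual o P) := ⟨y₀, hy₀⟩
  have hc' : SimpleCorner o 0 P (dual o P) (τ y) (fun k => σ (us k)) fun k => τ (w k) :=
    SimpleCorner.map (u := us) (y₀ := y) hc hστ
  have hP₂ : IsPolytope (dual o P) ∧ IsSimpleVertex (dual o P) (τ y) ∧
      Function.Injective (fun k => (τ (w k) : E (2 * i))) ∧
      range (fun k => (τ (w k) : E (2 * i))) = neighbours (dual o P) (τ y) :=
    ⟨hc'.isPolytope h, hc'.isSimpleVertex h, hc'.injective_right, hc'.range_eq_neighbours h⟩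
  refine ⟨τ y, fun k => τ (w k), ?_, fun k => hτ (w k), ?_, ?_⟩
  · rw [← hτ y]
    congr 3
    exact Subtype.ext hFy
  · -- the affine map can be taken to be the identity, for a suitable projective map
    obtain ⟨T, hpos, hsucc, hzero, hsub⟩ := hc.exists_projective h ⟨_, hc'.affineIndependent⟩
    exact ⟨_, ⟨hP, hu, hF, hH⟩, hP₂, T, _, AffineEquiv.refl ℝ _, hpos, hsucc, hzero, hsub, rfl,
      fun _ => rfl, rfl⟩
  · rintro M ⟨-, -, T, S, α, hpos, hsucc, hzero, hsub, hv, hnb, rfl⟩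
    have m : MergeSetup o 0 P (dual o P) y us w σ τ T S α :=
      ⟨h, hc, hστ, hpos, hsucc, hzero, hsub, hv, hnb⟩
    exact ⟨m.isPolytope, m.isSelfDual⟩
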